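/- Let $w\ge 2$ be real, let $W=\prod_{p\le w}p$ be the product of the primes up to $w$, let $b$ be an integer with $(b,W)=1$, let $0<\delta<1/2$, and for a positive integer $N$ put $z=N^{1/2-\delta}$. Let $P$ be the product of the primes $p<z$ with $p\nmid W$, let $J=\sum_{d\mid P,\ d<z}1/\phi(d)$, and let $(\rho_d)_{d\mid P}$ be Selberg's weights $$\rho_d=\frac{\mu(d)\,d}{J}\sum_{\substack{m\mid P,\ m<z\\ d\mid m}}\frac1{\phi(m)},$$ that is, the weights for which $y_d=\mu(d)\phi(d)\sum_{m\mid P,\ d\mid m}\rho_m/m$ equals $J^{-1}$ for $d\mid P$ with $d<z$, and $0$ for $d\mid P$ with $d\ge z$. Selberg's majorant $\nu:[1,N]\to\mathbb R$ for the primes $Wn+b$ is $$\nu(n)=\frac{\phi(W)}{W}\log z\Bigl(\sum_{d\mid (Wn+b,P)}\rho_d\Bigr)^2 .$$ Theorem. For every $\epsilon>0$ there is a constant $C_\epsilon$, depending only on $\epsilon$, such that the following holds. For all $w$ and $\delta$ as above there is $N_0=N_0(w,\delta)$ such that for all $N\ge N_0$, all integers $b$ coprime to $W$, all $\epsilon>0$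 and all $r\in\mathbb Z/N\mathbb Z$, $$\Bigl|\sum_{n=1}^N\nu(n)e^{2\pi i nr/N}-\delta_{r,0}N\Bigr|\le C_\epsilon\, w^{-1+\epsilon}N ,$$ where $\delta_{r,0}$ is $1$ if $r=0$ and $0$ otherwise. In other words, $\nu$ is $C_\epsilon w^{-1+\epsilon}$-pseudorandom. -/

import Mathlib

/-- The product `P = P(z, W)` of all primes `p < z` not dividing `W`. -/
noncomputable def selbergP (z : ℝ) (W : ℕ) : ℕ :=
  ∏ p ∈ (Finset.range ⌈z⌉₊).filter (fun p => p.Prime ∧ p.Coprime W), p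

/-- The normalising sum `J = ∑ 1 / φ(d)`, over the divisors `d < z` of `P(z, W)`. -/
noncomputable def selbergJ (z : ℝ) (W : ℕ) : ℝ :=
  ∑ d ∈ (selbergP z W).divisors.filter (fun d : ℕ => (d : ℝ) < z), 1 / (d.totient : ℝ)

/-- Selberg's weights
`ρ_d = μ(d) d J⁻¹ ∑ 1 / φ(m)`, over the divisors `m < z` of `P(z, W)` that are multiples of `d`.
They vanish unless `d ∣ P(z, W)` and `d < z`, and they are the weights for which
`y_d = μ(d) φ(d) ∑_{d ∣ m} ρ_m / m` equals `J⁻¹` for every divisor `d < z` of `P(z, W)` and `0`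
for the other divisors: see `selbergWeight_diagonal`. -/
noncomputable def selbergWeight (z : ℝ) (W d : ℕ) : ℝ :=
  (ArithmeticFunction.moebius d : ℝ) * d * (selbergJ z W)⁻¹ *
    ∑ m ∈ (selbergP z W).divisors.filter (fun m : ℕ => d ∣ m ∧ (m : ℝ) < z), 1 / (m.totient : ℝ)

/-- Selberg's majorant for the primes of the form `W n + b`, with sieve parameter `z`:
`ν(n) = (φ(W) / W) (log z) (∑_{d ∣ (W n + b, P)} ρ_d)²`. -/
noncomputable def selbergMajorant (z : ℝ) (W : ℕ) (b : ℤ) (n : ℕ) : ℝ :=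
  (W.totient : ℝ) / W * Real.log z *
    (∑ d ∈ (selbergP z W).divisors.filter (fun d : ℕ => (d : ℤ) ∣ (W : ℤ) * n + b),
      selbergWeight z W d) ^ 2

/-- The Fourier transform `θ ↦ ∑_{1 ≤ n ≤ N} f(n) e(n θ)`, `e(x) = exp(2 π i x)`, of a function
on `[1, N]` (only the values of `f` on `[1, N]` are used). -/
noncomputable def fourierSum (N : ℕ) (f : ℕ → ℝ) (θ : ℝ) : ℂ :=
  ∑ n ∈ Finset.Icc 1 N, (f n : ℂ) * Complex.exp (2 * Real.pi * Complex.I * (n * θ : ℝ))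

/-- A function `f : [1, N] → ℝ` is `η`-pseudorandom if `|f̂(r / N) - δ_{r,0} N| ≤ η N` for each
residue class `r` modulo `N`. -/
def IsPseudorandom (N : ℕ) (η : ℝ) (f : ℕ → ℝ) : Prop :=
  ∀ r : ZMod N,
    ‖fourierSum N f ((r.val : ℝ) / N) - (if r = 0 then (N : ℂ) else 0)‖ ≤ η * N

theorem selbergP_ne_zero (z : ℝ) (W : ℕ) : selbergP z W ≠ 0 := by
  unfold selbergP
  refine Finset.prod_ne_zero_iff.2 fun p hp => ?_
  exact (Finset.mem_filter.1 hp).2.1.ne_zero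

theorem selbergP_squarefree (z : ℝ) (W : ℕ) : Squarefree (selbergP z W) := by
  unfold selbergP
  refine Finset.squarefree_prod_of_pairwise_isCoprime ?_ ?_
  · intro p hp q hq hpq
    have hp' := (Finset.mem_filter.1 (Finset.mem_coe.1 hp)).2.1
    have hq' := (Finset.mem_filter.1 (Finset.mem_coe.1 hq)).2.1
    exact Nat.coprime_iff_isRelPrime.1 ((Nat.coprime_primes hp' hq').2 hpq)
  · intro p hp
    exact (Finset.mem_filter.1 hp).2.1.squarefree

theorem selbergWeight_one {z : ℝ} (hz : 1 < z) (W : ℕ) : selbergWeight z W 1 = 1 := by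
  have hJ : 0 < selbergJ z W := by
    unfold selbergJ
    refine Finset.sum_pos (fun d hd => ?_) ⟨1, ?_⟩
    · have := Nat.pos_of_mem_divisors (Finset.mem_filter.1 hd).1
      have := Nat.totient_pos.2 this
      positivity
    · simp [selbergP_ne_zero, hz]
  unfold selbergWeight
  simp only [one_dvd, true_and]
  rw [← selbergJ]
  simp [hJ.ne']

theorem sum_moebius_between {d k : ℕ} (hk : Squarefree k) (hdk : d ∣ k) :
    ∑ m ∈ k.divisors.filter (fun m => d ∣ m), ArithmeticFunction.moebius m =
      if k = d then ArithmeticFunction.moebius d else 0 := by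
  obtain ⟨e, rfl⟩ := hdk
  have hne := hk.ne_zero
  have hd : d ≠ 0 := left_ne_zero_of_mul hne
  have he : e ≠ 0 := right_ne_zero_of_mul hne
  have hcop : d.Coprime e := Nat.coprime_of_squarefree_mul hk
  have himg : (d * e).divisors.filter (fun m => d ∣ m) = e.divisors.image (fun x => d * x) := by
    ext m
    simp only [Finset.mem_filter, Nat.mem_divisors, Finset.mem_image]
    constructor
    · rintro ⟨⟨h1, -⟩, x, rfl⟩
      exact ⟨x, ⟨Nat.dvd_of_mul_dvd_mul_left (Nat.pos_of_ne_zero hd) h1, he⟩, rfl⟩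
    · rintro ⟨x, ⟨hx, -⟩, rfl⟩
      exact ⟨⟨Nat.mul_dvd_mul_left d hx, hne⟩, Dvd.intro x rfl⟩
  rw [himg, Finset.sum_image (fun x _ y _ h => Nat.eq_of_mul_eq_mul_left (Nat.pos_of_ne_zero hd) h)]
  have hmul : ∀ x ∈ e.divisors, ArithmeticFunction.moebius (d * x) =
      ArithmeticFunction.moebius d * ArithmeticFunction.moebius x := fun x hx =>
    ArithmeticFunction.isMultiplicative_moebius.map_mul_of_coprime
      (hcop.coprime_dvd_right (Nat.dvd_of_mem_divisors hx))
  rw [Finset.sum_congr rfl hmul, ← Finset.mul_sum,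
    ← ArithmeticFunction.coe_mul_zeta_apply, ArithmeticFunction.moebius_mul_coe_zeta,
    ArithmeticFunction.one_apply]
  by_cases h : e = 1
  · simp [h]
  · have : d * e ≠ d := fun h' => h (by simpa [hd] using h')
    simp [h, this]

/-- The linear change of variables that determines Selberg's weights. -/
theorem selbergWeight_diagonal (z : ℝ) (W d : ℕ) (hd : d ∣ selbergP z W) :
    (ArithmeticFunction.moebius d : ℝ) * d.totient *
      ∑ m ∈ (selbergP z W).divisors.filter (fun m => d ∣ m), selbergWeight z W m / m =
    if (d : ℝ) < z then (selbergJ z W)⁻¹ else 0 := by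
  have hsq := selbergP_squarefree z W
  have hP := selbergP_ne_zero z W
  have h1 : ∀ m ∈ (selbergP z W).divisors.filter (fun m => d ∣ m), selbergWeight z W m / m =
      (selbergJ z W)⁻¹ * ∑ k ∈ (selbergP z W).divisors.filter (fun k : ℕ => m ∣ k ∧ (k : ℝ) < z),
        (ArithmeticFunction.moebius m : ℝ) * (1 / (k.totient : ℝ)) := by
    intro m hm
    have hm0 : (m : ℝ) ≠ 0 :=
      Nat.cast_ne_zero.2 (Nat.pos_of_mem_divisors (Finset.mem_filter.1 hm).1).ne'
    rw [← Finset.mul_sum, selbergWeight]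
    field_simp
  rw [Finset.sum_congr rfl h1, ← Finset.mul_sum,
    Finset.sum_comm' (t' := (selbergP z W).divisors.filter (fun k : ℕ => (k : ℝ) < z))
      (s' := fun k => k.divisors.filter (fun m => d ∣ m))]
  swap
  · intro m k
    simp only [Finset.mem_filter, Nat.mem_divisors]
    constructor
    · rintro ⟨⟨-, h2⟩, ⟨h3, -⟩, h4, h5⟩
      exact ⟨⟨⟨h4, fun h => hP (by simpa [h] using h3)⟩, h2⟩, ⟨h3, hP⟩, h5⟩
    · rintro ⟨⟨⟨h4, -⟩, h2⟩, ⟨h3, -⟩, h5⟩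
      exact ⟨⟨⟨h4.trans h3, hP⟩, h2⟩, ⟨h3, hP⟩, h4, h5⟩
  have h2 : ∀ k ∈ (selbergP z W).divisors.filter (fun k : ℕ => (k : ℝ) < z),
      ∑ m ∈ k.divisors.filter (fun m => d ∣ m),
        (ArithmeticFunction.moebius m : ℝ) * (1 / (k.totient : ℝ)) =
      if k = d then (ArithmeticFunction.moebius d : ℝ) * (1 / (d.totient : ℝ)) else 0 := by
    intro k hk
    have hkP := Nat.dvd_of_mem_divisors (Finset.mem_filter.1 hk).1
    rw [← Finset.sum_mul]
    by_cases hdk : d ∣ k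
    · have h3 := sum_moebius_between (hsq.squarefree_of_dvd hkP) hdk
      rw [← Int.cast_sum, h3]
      split_ifs with h
      · rw [h]
      · simp
    · have hne : k ≠ d := fun h => hdk (h ▸ dvd_rfl)
      rw [if_neg hne, Finset.sum_eq_zero, zero_mul]
      intro m hm
      obtain ⟨h4, h5⟩ := Finset.mem_filter.1 hm
      exact absurd (h5.trans (Nat.dvd_of_mem_divisors h4)) hdk
  rw [Finset.sum_congr rfl h2, Finset.sum_ite_eq']
  have hφ : (d.totient : ℝ) ≠ 0 :=
    Nat.cast_ne_zero.2 (Nat.totient_pos.2 (Nat.pos_of_dvd_of_pos hd (Nat.pos_of_ne_zero hP))).ne'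
  have hμ : (ArithmeticFunction.moebius d : ℝ) * (ArithmeticFunction.moebius d : ℝ) = 1 := by
    have := ArithmeticFunction.moebius_sq_eq_one_of_squarefree (hsq.squarefree_of_dvd hd)
    rw [← sq]
    exact_mod_cast this
  by_cases hz : (d : ℝ) < z
  · rw [if_pos hz, if_pos (by simp [hd, hP, hz])]
    field_simp
    linear_combination (selbergJ z W)⁻¹ * hμ
  · rw [if_neg hz, if_neg (by simp [hz])]
    simp

/-! Write c = (φ(W)/W) log z and let E(D) be the sum of e(nθ) over n ≤ N with D ∣ Wn + b. Expanding
the square gives ν̂(θ) = c ∑ ρ_{d₁} ρ_{d₂} E([d₁, d₂]) (`fourierSum_selbergMajorant`), where only D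
= [d₁, d₂] < z² = N^(1-2δ) matter. Let a/q be a Dirichlet approximation of θ = r/N with q ≤ N^(1-δ).

If q ≤ N^δ and q ∤ D, then Dθ stays 1/(2q) away from the integers, so |E(D)| ≤ q. If q ≤ N^δ and q ∣
D, then E(D) = G/D + O(N^δ) with G independent of D and |G| ≤ N. Hence ν̂(θ) is close to c L(q) G,
where L(q), called `lcmCoeff`, is the sum of ρ_{d₁} ρ_{d₂} / [d₁, d₂] over pairs with q ∣ [d₁, d₂].
If q ≥ N^δ, then E(D) is small on average over D, since the points Dθ are well spaced in short
blocks (`sum_Icc_le_of_spaced`). In both cases the total error `fourierError` is o(N / log N),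
because the weights are bounded by the divisor function.

The arithmetic is all in L(q). Selberg's diagonalisation gives L(1) = 1/J and |L(q)| ≤ τ(q)⁴/(qJ)
(`lcmCoeff_one`, `abs_lcmCoeff_le`), and c/J → 1 (`tendsto_log_div_selbergJ`). So q = 1 yields the
main term, G being then a complete sum over N-th roots of unity. For q > 1, L(q) vanishes unless q ∣
P; then q is coprime to W, so q > w, and the contribution is O(w^(-1+ε) N). The errors that tend to
0 are only asked to be below 1/w, which is why N₀ does not depend on ε. -/

namespace SelbergPseudorandom

/-! ### The divisor bound. -/

/-- A natural number is at most its totient times its number of divisors. -/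
theorem le_totient_mul_card_divisors (n : ℕ) : n ≤ n.totient * n.divisors.card := by
  rcases Nat.eq_zero_or_pos n with rfl | hn
  · simp
  calc n = ∑ d ∈ n.divisors, d.totient := (Nat.sum_totient n).symm
    _ ≤ ∑ _d ∈ n.divisors, n.totient := Finset.sum_le_sum fun d hd =>
        Nat.le_of_dvd (Nat.totient_pos.2 hn) (Nat.totient_dvd_of_dvd (Nat.dvd_of_mem_divisors hd))
    _ = n.totient * n.divisors.card := by rw [Finset.sum_const, smul_eq_mul, mul_comm]

theorem add_one_le_mul_two_rpow {η : ℝ} (hη : 0 < η) (a : ℕ) :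
    (a : ℝ) + 1 ≤ (1 + 1 / (η * Real.log 2)) * (2 : ℝ) ^ (a * η) := by
  have hl : 0 < Real.log 2 := Real.log_pos one_lt_two
  have h1 : (a : ℝ) * η * Real.log 2 + 1 ≤ (2 : ℝ) ^ (a * η) := by
    rw [Real.rpow_def_of_pos two_pos, mul_comm (Real.log 2)]
    exact Real.add_one_le_exp _
  have h2 : 0 ≤ (a : ℝ) * η * Real.log 2 := by positivity
  have h3 : (0 : ℝ) < 1 / (η * Real.log 2) := by positivity
  calc (a : ℝ) + 1 = 1 / (η * Real.log 2) * (a * η * Real.log 2) + 1 := by field_simp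
    _ ≤ (1 + 1 / (η * Real.log 2)) * (a * η * Real.log 2 + 1) := by nlinarith
    _ ≤ _ := by gcongr

/-- The divisor bound `τ(n) ≪_η n ^ η`. -/
theorem exists_card_divisors_le_rpow {η : ℝ} (hη : 0 < η) :
    ∃ C : ℝ, 1 ≤ C ∧ ∀ n : ℕ, (n.divisors.card : ℝ) ≤ C * (n : ℝ) ^ η := by
  set K : ℝ := 1 + 1 / (η * Real.log 2) with hK
  have hl : 0 < Real.log 2 := Real.log_pos one_lt_two
  have hK1 : 1 ≤ K := by rw [hK]; have : 0 < 1 / (η * Real.log 2) := by positivity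
                         linarith
  -- For p ≥ Y one has p^η ≥ 2, so the local factor a + 1 ≤ 2^a costs nothing. Only the fewer than Y
  -- + 1 smaller primes cost a factor K each.
  set Y : ℕ := ⌈(2 : ℝ) ^ (1 / η)⌉₊ with hY
  refine ⟨K ^ Y, one_le_pow₀ hK1, fun n => ?_⟩
  rcases eq_or_ne n 0 with rfl | hn
  · simp [Real.zero_rpow hη.ne']
  have hn' : (n : ℝ) ^ η = ∏ p ∈ n.primeFactors, (p : ℝ) ^ (n.factorization p * η) := by
    conv_lhs => rw [← Nat.prod_factorization_pow_eq_self hn]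
    rw [Finsupp.prod, Nat.support_factorization, Nat.cast_prod,
      ← Real.finsetProd_rpow _ _ (fun _ _ => by positivity)]
    refine Finset.prod_congr rfl fun p _ => ?_
    rw [Nat.cast_pow, ← Real.rpow_natCast, ← Real.rpow_mul (by positivity)]
  have hstep : ∀ p ∈ n.primeFactors, ((n.factorization p : ℝ) + 1) ≤
      (if p < Y then K else 1) * (p : ℝ) ^ (n.factorization p * η) := by
    intro p hp
    have hp2 : (2 : ℝ) ≤ p := by exact_mod_cast (Nat.prime_of_mem_primeFactors hp).two_le
    split_ifs with h
    · refine (add_one_le_mul_two_rpow hη _).trans ?_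
      gcongr
    · have h2 : (2 : ℝ) ^ (1 / η) ≤ p := (Nat.le_ceil _).trans (by exact_mod_cast not_lt.1 h)
      have h3 : (2 : ℝ) ≤ (p : ℝ) ^ η := by
        calc (2 : ℝ) = ((2 : ℝ) ^ (1 / η)) ^ η := by
              rw [← Real.rpow_mul (by norm_num), one_div_mul_cancel hη.ne', Real.rpow_one]
          _ ≤ _ := by gcongr
      have h4 : (n.factorization p : ℝ) + 1 ≤ 2 ^ (n.factorization p) := by
        exact_mod_cast Nat.lt_two_pow_self
      rw [one_mul, mul_comm, Real.rpow_mul (by positivity), Real.rpow_natCast]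
      exact h4.trans (by gcongr)
  calc (n.divisors.card : ℝ) = ∏ p ∈ n.primeFactors, ((n.factorization p : ℝ) + 1) := by
        rw [Nat.card_divisors hn]; push_cast; rfl
    _ ≤ ∏ p ∈ n.primeFactors, (if p < Y then K else 1) * (p : ℝ) ^ (n.factorization p * η) :=
        Finset.prod_le_prod (fun _ _ => by positivity) hstep
    _ = K ^ (n.primeFactors.filter (· < Y)).card * (n : ℝ) ^ η := by
        rw [Finset.prod_mul_distrib, ← hn', Finset.prod_ite, Finset.prod_const, Finset.prod_const_one,
          mul_one]
    _ ≤ K ^ Y * (n : ℝ) ^ η := by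
        gcongr
        · calc _ ≤ (Finset.range Y).card := Finset.card_le_card fun p hp => by
                simpa using (Finset.mem_filter.1 hp).2
            _ = Y := Finset.card_range Y

theorem card_divisors_le_of_dvd {d n : ℕ} (hn : n ≠ 0) (h : d ∣ n) :
    d.divisors.card ≤ n.divisors.card :=
  Finset.card_le_card (Nat.divisors_subset_of_dvd hn h)

/-! ### Divisibility of squarefree numbers -/

/-- Checked prime by prime: a prime factor of v that divides [d₁, d₂] divides d₁ or d₂. The
condition on a pair thus depends only on the gcds with v, by which pairs are sorted in
`lcmCoeff_eq`. -/
theorem dvd_lcm_gcd_iff {v d₁ d₂ : ℕ} (hv : Squarefree v) :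
    v ∣ (d₁.gcd v).lcm (d₂.gcd v) ↔ v ∣ d₁.lcm d₂ := by
  refine ⟨fun h => h.trans (Nat.lcm_dvd ((Nat.gcd_dvd_left _ _).trans (Nat.dvd_lcm_left _ _))
    ((Nat.gcd_dvd_left _ _).trans (Nat.dvd_lcm_right _ _))), fun h => ?_⟩
  rw [← Nat.prod_primeFactors_of_squarefree hv]
  refine Finset.prod_primes_dvd _ (fun p hp => (Nat.prime_of_mem_primeFactors hp).prime) ?_
  rw [Nat.prod_primeFactors_of_squarefree hv]
  intro p hp
  have hpp := Nat.prime_of_mem_primeFactors hp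
  have hpv := Nat.dvd_of_mem_primeFactors hp
  rcases hpp.dvd_mul.1 ((hpv.trans h).trans (Nat.lcm_dvd_mul _ _)) with h1 | h1
  · exact (Nat.dvd_gcd h1 hpv).trans (Nat.dvd_lcm_left _ _)
  · exact (Nat.dvd_gcd h1 hpv).trans (Nat.dvd_lcm_right _ _)

theorem sum_moebius_divisors (n : ℕ) :
    ∑ m ∈ n.divisors, ArithmeticFunction.moebius m = if n = 1 then 1 else 0 := by
  rw [← ArithmeticFunction.coe_mul_zeta_apply, ArithmeticFunction.moebius_mul_coe_zeta,
    ArithmeticFunction.one_apply]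

/-- Möbius inversion for the condition `(d, v) = e`. -/
theorem sum_moebius_mul_dvd {v d e : ℕ} (hv : v ≠ 0) (hev : e ∣ v) :
    ∑ f ∈ (v / e).divisors, (if e * f ∣ d then ArithmeticFunction.moebius f else 0) =
      if d.gcd v = e then 1 else 0 := by
  obtain ⟨u, rfl⟩ := hev
  have he : 0 < e := Nat.pos_of_ne_zero (left_ne_zero_of_mul hv)
  have hu : u ≠ 0 := right_ne_zero_of_mul hv
  rw [Nat.mul_div_cancel_left _ he, ← Finset.sum_filter]
  by_cases hd : e ∣ d
  · obtain ⟨k, rfl⟩ := hd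
    have h1 : u.divisors.filter (fun f => e * f ∣ e * k) = (k.gcd u).divisors := by
      ext f
      simp only [Finset.mem_filter, Nat.mem_divisors, Nat.mul_dvd_mul_iff_left he, Nat.dvd_gcd_iff]
      have : k.gcd u ≠ 0 := Nat.gcd_ne_zero_right hu
      tauto
    rw [h1, sum_moebius_divisors, Nat.gcd_mul_left]
    simp [he.ne']
  · rw [Finset.sum_eq_zero, if_neg]
    · rintro h; exact hd (h ▸ Nat.gcd_dvd_left _ _)
    · intro f hf
      exact absurd ((Dvd.intro _ rfl).trans (Finset.mem_filter.1 hf).2) hd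

/-- The gcd g is squarefree, so g = (g, v) h with h coprime to v, and h = ∑_{m ∣ h} φ(m). This
separates the variables d₁ and d₂ in 1/[d₁, d₂] = (d₁, d₂)/(d₁ d₂) once their gcds with v are fixed.
-/
theorem gcd_eq_mul_sum_totient {P d₁ d₂ v : ℕ} (hP : Squarefree P) (h1 : d₁ ∣ P) :
    d₁.gcd d₂ = (d₁.gcd v).gcd (d₂.gcd v) *
      ∑ m ∈ P.divisors.filter (fun m => m.Coprime v), if m ∣ d₁ ∧ m ∣ d₂ then m.totient else 0 := by
  set g := d₁.gcd d₂ with hg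
  have hgP : g ∣ P := (Nat.gcd_dvd_left _ _).trans h1
  have hgs : Squarefree g := hP.squarefree_of_dvd hgP
  have hgv : (d₁.gcd v).gcd (d₂.gcd v) = g.gcd v := by
    refine Nat.dvd_antisymm ?_ ?_
    · exact Nat.dvd_gcd (Nat.dvd_gcd ((Nat.gcd_dvd_left _ _).trans (Nat.gcd_dvd_left _ _))
        ((Nat.gcd_dvd_right _ _).trans (Nat.gcd_dvd_left _ _)))
        ((Nat.gcd_dvd_left _ _).trans (Nat.gcd_dvd_right _ _))
    · exact Nat.dvd_gcd (Nat.gcd_dvd_gcd_of_dvd_left _ (Nat.gcd_dvd_left _ _))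
        (Nat.gcd_dvd_gcd_of_dvd_left _ (Nat.gcd_dvd_right _ _))
  obtain ⟨h, hh⟩ : g.gcd v ∣ g := Nat.gcd_dvd_left _ _
  have hh0 : h ≠ 0 := by rintro rfl; exact hgs.ne_zero (by simpa using hh)
  have hcop : (g.gcd v).Coprime h := Nat.coprime_of_squarefree_mul (hh ▸ hgs)
  have hhv : h.Coprime v := by
    have : h.gcd v ∣ (g.gcd v).gcd h := Nat.dvd_gcd
      (Nat.dvd_gcd ((Nat.gcd_dvd_left _ _).trans (hh ▸ Dvd.intro_left _ rfl)) (Nat.gcd_dvd_right _ _))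
      (Nat.gcd_dvd_left _ _)
    rw [hcop.gcd_eq_one] at this
    exact Nat.dvd_one.1 this
  have hset : (P.divisors.filter (fun m => m.Coprime v)).filter (fun m => m ∣ d₁ ∧ m ∣ d₂) =
      h.divisors := by
    ext m
    simp only [Finset.mem_filter, Nat.mem_divisors, ← Nat.dvd_gcd_iff, ← hg]
    constructor
    · rintro ⟨⟨-, h3⟩, h4⟩
      refine ⟨?_, hh0⟩
      rw [hh] at h4
      exact (h3.coprime_dvd_right (Nat.gcd_dvd_right _ _)).dvd_of_dvd_mul_left h4
    · rintro ⟨h3, -⟩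
      have h4 : m ∣ g := h3.trans (hh ▸ Dvd.intro_left _ rfl)
      exact ⟨⟨⟨h4.trans hgP, hP.ne_zero⟩, hhv.coprime_dvd_left h3⟩, h4⟩
  rw [← Finset.sum_filter, hset, Nat.sum_totient, hgv]
  exact hh

/-- For squarefree u, 1/φ(f) = φ(u/f)/φ(u), and the totients of the divisors add up to u. -/
theorem sum_one_div_totient_divisors {u : ℕ} (hu : Squarefree u) :
    ∑ f ∈ u.divisors, 1 / (f.totient : ℝ) = u / u.totient := by
  have hu0 := hu.ne_zero
  have h1 : ∀ f ∈ u.divisors, 1 / (f.totient : ℝ) = ((u / f).totient : ℝ) / u.totient := by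
    intro f hf
    obtain ⟨k, rfl⟩ := Nat.dvd_of_mem_divisors hf
    have hf0 := Nat.pos_of_ne_zero (left_ne_zero_of_mul hu0)
    have hk0 := Nat.pos_of_ne_zero (right_ne_zero_of_mul hu0)
    have := Nat.totient_pos.2 hf0
    have := Nat.totient_pos.2 hk0
    rw [Nat.mul_div_cancel_left _ hf0, Nat.totient_mul (Nat.coprime_of_squarefree_mul hu)]
    push_cast
    field_simp
  rw [Finset.sum_congr rfl h1, ← Finset.sum_div, Nat.sum_div_divisors u (fun k => (k.totient : ℝ)),
    ← Nat.cast_sum, Nat.sum_totient]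

/-! ### Selberg's weights -/

theorem selbergJ_pos {z : ℝ} (hz : 1 < z) (W : ℕ) : 0 < selbergJ z W := by
  refine Finset.sum_pos (fun d hd => ?_) ⟨1, ?_⟩
  · have := Nat.pos_of_mem_divisors (Finset.mem_filter.1 hd).1
    have := Nat.totient_pos.2 this
    positivity
  · simp [selbergP_ne_zero, hz]

theorem selbergWeight_eq_zero {z : ℝ} {W d : ℕ} (hd : z ≤ d) : selbergWeight z W d = 0 := by
  rw [selbergWeight, Finset.sum_eq_zero, mul_zero]
  intro m hm
  obtain ⟨h1, h2, h3⟩ := Finset.mem_filter.1 hm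
  have : (d : ℝ) ≤ m := by exact_mod_cast Nat.le_of_dvd (Nat.pos_of_mem_divisors h1) h2
  linarith

/-- Write m = dk with φ(m) = φ(d) φ(k); the cofactors k are distinct divisors of P below z. -/
theorem sum_one_div_totient_multiples_le {P d : ℕ} (hP : Squarefree P) {z : ℝ} :
    ∑ m ∈ P.divisors.filter (fun m : ℕ => d ∣ m ∧ (m : ℝ) < z), 1 / (m.totient : ℝ) ≤
      1 / (d.totient : ℝ) * ∑ m ∈ P.divisors.filter (fun m : ℕ => (m : ℝ) < z),
        1 / (m.totient : ℝ) := by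
  have hP0 := hP.ne_zero
  have h1 : ∀ m ∈ P.divisors.filter (fun m : ℕ => d ∣ m ∧ (m : ℝ) < z), 1 / (m.totient : ℝ) =
      1 / (d.totient : ℝ) * (1 / ((m / d).totient : ℝ)) := by
    intro m hm
    obtain ⟨h1, ⟨k, rfl⟩, h3⟩ := Finset.mem_filter.1 hm
    have hm0 := (Nat.pos_of_mem_divisors h1).ne'
    rw [Nat.mul_div_cancel_left _ (Nat.pos_of_ne_zero (left_ne_zero_of_mul hm0)), Nat.totient_mul
      (Nat.coprime_of_squarefree_mul (hP.squarefree_of_dvd (Nat.dvd_of_mem_divisors h1)))]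
    push_cast
    rw [one_div_mul_one_div]
  rw [Finset.sum_congr rfl h1, ← Finset.mul_sum]
  refine mul_le_mul_of_nonneg_left ?_ (by positivity)
  rw [← Finset.sum_image (g := fun m => m / d) (f := fun m : ℕ => 1 / (m.totient : ℝ))]
  · refine Finset.sum_le_sum_of_subset_of_nonneg ?_ (fun _ _ _ => by positivity)
    intro k hk
    obtain ⟨m, hm, rfl⟩ := Finset.mem_image.1 hk
    obtain ⟨h1, h2, h3⟩ := Finset.mem_filter.1 hm
    refine Finset.mem_filter.2 ⟨Nat.mem_divisors.2
      ⟨(Nat.div_dvd_of_dvd h2).trans (Nat.dvd_of_mem_divisors h1), hP0⟩, lt_of_le_of_lt ?_ h3⟩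
    exact_mod_cast Nat.div_le_self m d
  · intro m hm m' hm' h
    have h2 := (Finset.mem_filter.1 hm).2.1
    have h2' := (Finset.mem_filter.1 hm').2.1
    rw [← Nat.mul_div_cancel' h2, ← Nat.mul_div_cancel' h2']
    exact congrArg (d * ·) h

theorem abs_moebius_le_one (n : ℕ) : |(ArithmeticFunction.moebius n : ℝ)| ≤ 1 := by
  exact_mod_cast ArithmeticFunction.abs_moebius_le_one (n := n)

theorem div_totient_le_card_divisors (n : ℕ) : (n : ℝ) / n.totient ≤ n.divisors.card := by
  rcases Nat.eq_zero_or_pos n with rfl | hn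
  · simp
  have := Nat.totient_pos.2 hn
  rw [div_le_iff₀ (by positivity), mul_comm]
  exact_mod_cast le_totient_mul_card_divisors n

/-- The previous inequality gives |ρ_d| ≤ d/φ(d) ≤ τ(d). This is weaker than the classical |ρ_d| ≤
1, but the error terms can afford any power of N with small exponent. -/
theorem abs_selbergWeight_le {z : ℝ} (hz : 1 < z) (W d : ℕ) :
    |selbergWeight z W d| ≤ d.divisors.card := by
  have hJ := selbergJ_pos hz W
  have h0 : 0 ≤ ∑ m ∈ (selbergP z W).divisors.filter (fun m : ℕ => d ∣ m ∧ (m : ℝ) < z),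
      1 / (m.totient : ℝ) := Finset.sum_nonneg fun _ _ => by positivity
  have h1 := sum_one_div_totient_multiples_le (d := d) (z := z) (selbergP_squarefree z W)
  rw [← selbergJ] at h1
  rw [selbergWeight, abs_mul, abs_mul, abs_mul, abs_of_nonneg h0, abs_of_pos (inv_pos.2 hJ),
    Nat.abs_cast]
  calc |(ArithmeticFunction.moebius d : ℝ)| * d * (selbergJ z W)⁻¹ * _
      ≤ 1 * d * (selbergJ z W)⁻¹ * (1 / (d.totient : ℝ) * selbergJ z W) := by
        gcongr
        exact abs_moebius_le_one d
    _ = d / d.totient := by field_simp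
    _ ≤ _ := div_totient_le_card_divisors d

/-! ### The quadratic form of the weights on pairs whose lcm is a multiple of v. -/

/-- `Y_k = ∑_{k ∣ m} ρ_m / m`. -/
noncomputable def weightSum (z : ℝ) (W k : ℕ) : ℝ :=
  ∑ m ∈ (selbergP z W).divisors.filter (fun m => k ∣ m), selbergWeight z W m / m

theorem abs_weightSum {z : ℝ} (hz : 1 < z) {W k : ℕ} (hk : k ∣ selbergP z W) :
    |weightSum z W k| = if (k : ℝ) < z then 1 / (selbergJ z W * k.totient) else 0 := by
  have hJ := selbergJ_pos hz W
  have hk0 : 0 < k.totient :=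
    Nat.totient_pos.2 (Nat.pos_of_dvd_of_pos hk (Nat.pos_of_ne_zero (selbergP_ne_zero z W)))
  have h1 := selbergWeight_diagonal z W k hk
  rw [← weightSum] at h1
  have h2 : |(ArithmeticFunction.moebius k : ℝ)| = 1 := by
    have := ArithmeticFunction.abs_moebius_eq_one_of_squarefree
      ((selbergP_squarefree z W).squarefree_of_dvd hk)
    exact_mod_cast this
  have h3 := congrArg abs h1
  rw [abs_mul, abs_mul, h2, Nat.abs_cast, one_mul] at h3
  split_ifs at h3 ⊢ with h
  · rw [abs_of_pos (inv_pos.2 hJ)] at h3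
    rw [eq_div_iff (by positivity)]
    field_simp at h3
    linarith
  · simpa [hk0.ne'] using h3

/-- `∑ ρ_d / d` over the `d` with `(d, v) = e` and `m ∣ d`. -/
noncomputable def gcdWeightSum (z : ℝ) (W v e m : ℕ) : ℝ :=
  ∑ d ∈ (selbergP z W).divisors, if d.gcd v = e ∧ m ∣ d then selbergWeight z W d / d else 0

/-- Möbius inversion detects (d, v) = e through the conditions ef ∣ d. As m is coprime to v, these
merge with m ∣ d into mef ∣ d, which brings in the diagonal variables. -/
theorem gcdWeightSum_eq {z : ℝ} {W v e m : ℕ} (hv : v ≠ 0) (he : e ∣ v)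
    (hm : m.Coprime v) :
    gcdWeightSum z W v e m =
      ∑ f ∈ (v / e).divisors, (ArithmeticFunction.moebius f : ℝ) * weightSum z W (m * (e * f)) := by
  have h1 : ∀ d ∈ (selbergP z W).divisors,
      (if d.gcd v = e ∧ m ∣ d then selbergWeight z W d / d else 0) =
      ∑ f ∈ (v / e).divisors, (ArithmeticFunction.moebius f : ℝ) *
        if m * (e * f) ∣ d then selbergWeight z W d / d else 0 := by
    intro d _
    have h2 := congrArg (Int.cast : ℤ → ℝ) (sum_moebius_mul_dvd (d := d) hv he)
    push_cast at h2
    by_cases hmd : m ∣ d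
    · have h3 : ∀ f ∈ (v / e).divisors, (ArithmeticFunction.moebius f : ℝ) *
          (if m * (e * f) ∣ d then selbergWeight z W d / d else 0) =
          (if e * f ∣ d then (ArithmeticFunction.moebius f : ℝ) else 0) *
            (selbergWeight z W d / d) := by
        intro f hf
        have hef : e * f ∣ v := Nat.mul_dvd_of_dvd_div he (Nat.dvd_of_mem_divisors hf)
        have h4 : m * (e * f) ∣ d ↔ e * f ∣ d :=
          ⟨fun h => (Dvd.intro_left _ rfl).trans h,
            fun h => (hm.coprime_dvd_right hef).mul_dvd_of_dvd_of_dvd hmd h⟩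
        simp only [h4]
        split_ifs <;> simp
      rw [Finset.sum_congr rfl h3, ← Finset.sum_mul, h2]
      simp [hmd]
    · rw [if_neg (fun h => hmd h.2), Finset.sum_eq_zero]
      intro f _
      rw [if_neg (fun h => hmd ((Dvd.intro _ rfl).trans h)), mul_zero]
  rw [gcdWeightSum, Finset.sum_congr rfl h1, Finset.sum_comm]
  refine Finset.sum_congr rfl fun f _ => ?_
  rw [← Finset.mul_sum, weightSum, Finset.sum_filter]

/-- With u = v/e, the terms are at most 1/(J φ(m) φ(e) φ(f)) for f ∣ u. Summing 1/φ(f) gives u/φ(u),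
and φ(e) φ(u) = φ(v). The support condition mef < z is relaxed to m < z. -/
theorem abs_gcdWeightSum_le {z : ℝ} (hz : 1 < z) {W v e m : ℕ} (hv : v ∣ selbergP z W)
    (he : e ∣ v) (hm : m.Coprime v) (hmP : m ∣ selbergP z W) :
    |gcdWeightSum z W v e m| ≤
      if (m : ℝ) < z then (v / e : ℝ) / (selbergJ z W * m.totient * v.totient) else 0 := by
  have hJ := selbergJ_pos hz W
  have hP := selbergP_ne_zero z W
  have hv0 : v ≠ 0 := fun h => hP (by simpa [h] using hv)
  have hm0 : m ≠ 0 := fun h => hP (by simpa [h] using hmP)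
  have hvs := (selbergP_squarefree z W).squarefree_of_dvd hv
  obtain ⟨u, rfl⟩ := he
  have he0 : 0 < e := Nat.pos_of_ne_zero (left_ne_zero_of_mul hv0)
  have hu0 : 0 < u := Nat.pos_of_ne_zero (right_ne_zero_of_mul hv0)
  have hme := Nat.totient_pos.2 he0
  have hmu := Nat.totient_pos.2 hu0
  have hmm := Nat.totient_pos.2 (Nat.pos_of_ne_zero hm0)
  have hcop := Nat.coprime_of_squarefree_mul hvs
  rw [gcdWeightSum_eq hv0 (Dvd.intro _ rfl) hm, Nat.mul_div_cancel_left _ he0]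
  have h1 : ∀ f ∈ u.divisors, |(ArithmeticFunction.moebius f : ℝ) * weightSum z W (m * (e * f))| ≤
      if (m : ℝ) < z then 1 / (selbergJ z W * m.totient * e.totient) * (1 / f.totient) else 0 := by
    intro f hf
    have hfu := Nat.dvd_of_mem_divisors hf
    have hf0 := Nat.pos_of_mem_divisors hf
    have hef : e * f ∣ e * u := Nat.mul_dvd_mul_left _ hfu
    have hdvd : m * (e * f) ∣ selbergP z W :=
      (hm.coprime_dvd_right hef).mul_dvd_of_dvd_of_dvd hmP (hef.trans hv)
    rw [abs_mul]
    have h2 : |weightSum z W (m * (e * f))| ≤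
      if (m : ℝ) < z then 1 / (selbergJ z W * m.totient * e.totient) * (1 / f.totient) else 0 := by
      rw [abs_weightSum hz hdvd]
      by_cases h : (m : ℝ) < z
      · rw [if_pos h]
        split_ifs with h3
        · rw [Nat.totient_mul (hm.coprime_dvd_right hef),
            Nat.totient_mul (hcop.coprime_dvd_right hfu)]
          push_cast
          apply le_of_eq
          rw [one_div_mul_one_div]
          ring
        · positivity
      · rw [if_neg h, if_neg]
        intro h3
        apply h
        refine lt_of_le_of_lt ?_ h3
        exact_mod_cast Nat.le_mul_of_pos_right m (Nat.mul_pos he0 hf0)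
    calc _ ≤ 1 * |weightSum z W (m * (e * f))| := by
          gcongr
          exact abs_moebius_le_one f
      _ ≤ _ := by rw [one_mul]; exact h2
  refine (Finset.abs_sum_le_sum_abs _ _).trans ((Finset.sum_le_sum h1).trans ?_)
  split_ifs with h
  · rw [← Finset.mul_sum, sum_one_div_totient_divisors (hvs.squarefree_of_dvd (Dvd.intro_left _ rfl)),
      Nat.totient_mul hcop]
    push_cast
    apply le_of_eq
    field_simp
  · simp

/-- `∑ ρ_{d₁} ρ_{d₂} / [d₁, d₂]` over the pairs with `v ∣ [d₁, d₂]`. -/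
noncomputable def lcmCoeff (z : ℝ) (W v : ℕ) : ℝ :=
  ∑ d₁ ∈ (selbergP z W).divisors, ∑ d₂ ∈ (selbergP z W).divisors,
    if v ∣ d₁.lcm d₂ then selbergWeight z W d₁ * selbergWeight z W d₂ / (d₁.lcm d₂ : ℕ) else 0

/-- Sort the pairs by e₁ = (d₁, v) and e₂ = (d₂, v) and open the gcd with `gcd_eq_mul_sum_totient`:
for each m the sum becomes a product of a sum over d₁ and a sum over d₂. -/
theorem lcmCoeff_eq {z : ℝ} {W v : ℕ} (hv : v ∣ selbergP z W) :
    lcmCoeff z W v = ∑ e₁ ∈ v.divisors, ∑ e₂ ∈ v.divisors, if v ∣ e₁.lcm e₂ then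
      (e₁.gcd e₂ : ℝ) * ∑ m ∈ (selbergP z W).divisors.filter (fun m => m.Coprime v),
        (m.totient : ℝ) * (gcdWeightSum z W v e₁ m * gcdWeightSum z W v e₂ m) else 0 := by
  have hP := selbergP_ne_zero z W
  have hPs := selbergP_squarefree z W
  have hv0 : v ≠ 0 := fun h => hP (by simpa [h] using hv)
  set D := (selbergP z W).divisors with hD
  set M := D.filter (fun m => m.Coprime v) with hM
  set a : ℕ → ℝ := fun d => selbergWeight z W d / d with ha
  have hL : ∀ d₁ ∈ D, ∀ d₂ ∈ D,
      (if v ∣ d₁.lcm d₂ then selbergWeight z W d₁ * selbergWeight z W d₂ / (d₁.lcm d₂ : ℕ) else 0) =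
      ∑ e₁ ∈ v.divisors, ∑ e₂ ∈ v.divisors, if v ∣ e₁.lcm e₂ then (e₁.gcd e₂ : ℝ) *
        ∑ m ∈ M, (m.totient : ℝ) * ((if d₁.gcd v = e₁ ∧ m ∣ d₁ then a d₁ else 0) *
          (if d₂.gcd v = e₂ ∧ m ∣ d₂ then a d₂ else 0)) else 0 := by
    intro d₁ h1 d₂ h2
    -- For a given pair only one choice of e₁ and e₂ contributes, so the right side collapses to a
    -- single term.
    rw [Finset.sum_eq_single_of_mem (d₁.gcd v)
      (Nat.mem_divisors.2 ⟨Nat.gcd_dvd_right _ _, hv0⟩), Finset.sum_eq_single_of_mem (d₂.gcd v)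
      (Nat.mem_divisors.2 ⟨Nat.gcd_dvd_right _ _, hv0⟩)]
    · simp only [true_and, dvd_lcm_gcd_iff (hPs.squarefree_of_dvd hv)]
      split_ifs with h
      · have h3 : ∀ m ∈ M, (m.totient : ℝ) * ((if m ∣ d₁ then a d₁ else 0) *
            (if m ∣ d₂ then a d₂ else 0)) =
            ((if m ∣ d₁ ∧ m ∣ d₂ then m.totient else 0 : ℕ) : ℝ) * (a d₁ * a d₂) := by
          intro m _
          by_cases h4 : m ∣ d₁ <;> by_cases h5 : m ∣ d₂ <;> simp [h4, h5]
        rw [Finset.sum_congr rfl h3, ← Finset.sum_mul, ← Nat.cast_sum, ← mul_assoc, ← Nat.cast_mul,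
          ← gcd_eq_mul_sum_totient hPs (Nat.dvd_of_mem_divisors h1)]
        have h10 := Nat.pos_of_mem_divisors h1
        have h20 := Nat.pos_of_mem_divisors h2
        have h6 : ((d₁.gcd d₂ : ℕ) : ℝ) * (d₁.lcm d₂ : ℕ) = d₁ * d₂ := by
          exact_mod_cast Nat.gcd_mul_lcm d₁ d₂
        have h7 : (0 : ℝ) < (d₁.lcm d₂ : ℕ) := by exact_mod_cast Nat.lcm_pos h10 h20
        rw [ha, div_mul_div_comm, ← h6]
        have h8 : (0 : ℝ) < (d₁.gcd d₂ : ℕ) := by exact_mod_cast Nat.gcd_pos_of_pos_left _ h10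
        field_simp
      · rfl
    · intro e _ he
      split_ifs
      · rw [Finset.sum_eq_zero, mul_zero]
        intro m _
        rw [if_neg (c := d₂.gcd v = e ∧ m ∣ d₂) (fun h => he h.1.symm), mul_zero, mul_zero]
      · rfl
    · intro e _ he
      refine Finset.sum_eq_zero fun e₂ _ => ?_
      split_ifs
      · rw [Finset.sum_eq_zero, mul_zero]
        intro m _
        rw [if_neg (c := d₁.gcd v = e ∧ m ∣ d₁) (fun h => he h.1.symm), zero_mul, mul_zero]
      · rfl
  rw [lcmCoeff, Finset.sum_congr rfl fun d₁ h1 => Finset.sum_congr rfl fun d₂ h2 => hL d₁ h1 d₂ h2]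
  rw [Finset.sum_congr rfl fun d₁ _ => Finset.sum_comm, Finset.sum_comm]
  refine Finset.sum_congr rfl fun e₁ _ => ?_
  rw [Finset.sum_congr rfl fun d₁ _ => Finset.sum_comm, Finset.sum_comm]
  refine Finset.sum_congr rfl fun e₂ _ => ?_
  split_ifs
  · simp only [← Finset.mul_sum]
    congr 1
    rw [Finset.sum_congr rfl fun d₁ _ => Finset.sum_comm, Finset.sum_comm]
    refine Finset.sum_congr rfl fun m _ => ?_
    simp only [← Finset.mul_sum, gcdWeightSum]
    rw [Finset.sum_mul_sum]
    simp only [Finset.mul_sum]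
    rfl
  · simp

/-- For v = 1 the form is diagonal: ∑ φ(m) Y_m² = J⁻² ∑_{m < z} 1/φ(m) = J⁻¹. -/
theorem lcmCoeff_one {z : ℝ} (hz : 1 < z) (W : ℕ) : lcmCoeff z W 1 = (selbergJ z W)⁻¹ := by
  have hJ := selbergJ_pos hz W
  rw [lcmCoeff_eq (one_dvd _)]
  simp only [Nat.divisors_one, Finset.sum_singleton, one_dvd, if_true, Nat.gcd_self, Nat.cast_one,
    one_mul]
  have h1 : ∀ m ∈ (selbergP z W).divisors.filter (fun m => m.Coprime 1),
      (m.totient : ℝ) * (gcdWeightSum z W 1 1 m * gcdWeightSum z W 1 1 m) =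
      if (m : ℝ) < z then (selbergJ z W)⁻¹ ^ 2 * (1 / m.totient) else 0 := by
    intro m hm
    have hmd := (Finset.mem_filter.1 hm).1
    have hm0 := Nat.totient_pos.2 (Nat.pos_of_mem_divisors hmd)
    rw [gcdWeightSum_eq one_ne_zero dvd_rfl (Finset.mem_filter.1 hm).2]
    simp only [Nat.div_self one_pos, Nat.divisors_one, Finset.sum_singleton,
      ArithmeticFunction.moebius_apply_one, Int.cast_one, one_mul, mul_one]
    rw [← abs_mul_abs_self, abs_weightSum hz (Nat.dvd_of_mem_divisors hmd)]
    split_ifs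
    · field_simp
    · simp
  rw [Finset.sum_congr rfl h1, Finset.filter_true_of_mem (fun m _ => Nat.coprime_one_right m),
    ← Finset.sum_filter, ← Finset.mul_sum, ← selbergJ]
  field_simp

/-- There are at most τ(v)² pairs (e₁, e₂). Each surviving pair has lcm v, so (e₁, e₂) v = e₁ e₂ and
its contribution is at most v/(φ(v)² J), whatever the pair. Finally v/φ(v) ≤ τ(v). -/
theorem abs_lcmCoeff_le {z : ℝ} (hz : 1 < z) {W v : ℕ} (hv : v ∣ selbergP z W) :
    |lcmCoeff z W v| ≤ (v.divisors.card : ℝ) ^ 4 / (v * selbergJ z W) := by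
  have hJ := selbergJ_pos hz W
  have hP := selbergP_ne_zero z W
  have hv0 : v ≠ 0 := fun h => hP (by simpa [h] using hv)
  have hvφ := Nat.totient_pos.2 (Nat.pos_of_ne_zero hv0)
  have hvp : (0 : ℝ) < v := by exact_mod_cast Nat.pos_of_ne_zero hv0
  set M := (selbergP z W).divisors.filter (fun m => m.Coprime v) with hM
  set B : ℝ := v / (v.totient ^ 2 * selbergJ z W) with hB
  have hB0 : 0 ≤ B := by positivity
  have h1 : ∀ e₁ ∈ v.divisors, ∀ e₂ ∈ v.divisors, |(if v ∣ e₁.lcm e₂ then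
      (e₁.gcd e₂ : ℝ) * ∑ m ∈ M,
        (m.totient : ℝ) * (gcdWeightSum z W v e₁ m * gcdWeightSum z W v e₂ m) else 0)| ≤ B := by
    intro e₁ he₁ e₂ he₂
    have hd₁ := Nat.dvd_of_mem_divisors he₁
    have hd₂ := Nat.dvd_of_mem_divisors he₂
    have hp₁ : (0 : ℝ) < e₁ := by exact_mod_cast Nat.pos_of_mem_divisors he₁
    have hp₂ : (0 : ℝ) < e₂ := by exact_mod_cast Nat.pos_of_mem_divisors he₂
    split_ifs with h
    swap
    · simpa using hB0
    have hlcm : e₁.lcm e₂ = v := Nat.dvd_antisymm (Nat.lcm_dvd hd₁ hd₂) h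
    have hg : (e₁.gcd e₂ : ℝ) * v = e₁ * e₂ := by
      rw [← hlcm]; exact_mod_cast Nat.gcd_mul_lcm e₁ e₂
    have h2 : ∀ m ∈ M, |(m.totient : ℝ) * (gcdWeightSum z W v e₁ m * gcdWeightSum z W v e₂ m)| ≤
        if (m : ℝ) < z then (v / e₁ : ℝ) * (v / e₂) / (selbergJ z W ^ 2 * v.totient ^ 2) *
          (1 / m.totient) else 0 := by
      intro m hm
      obtain ⟨hm1, hm2⟩ := Finset.mem_filter.1 hm
      have hmφ := Nat.totient_pos.2 (Nat.pos_of_mem_divisors hm1)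
      have k1 := abs_gcdWeightSum_le hz hv hd₁ hm2 (Nat.dvd_of_mem_divisors hm1)
      have k2 := abs_gcdWeightSum_le hz hv hd₂ hm2 (Nat.dvd_of_mem_divisors hm1)
      rw [abs_mul, abs_mul, Nat.abs_cast]
      refine (mul_le_mul_of_nonneg_left (mul_le_mul k1 k2 (abs_nonneg _)
        ((abs_nonneg _).trans k1)) (Nat.cast_nonneg _)).trans (le_of_eq ?_)
      split_ifs
      · field_simp
      · simp
    rw [abs_mul, Nat.abs_cast]
    calc (e₁.gcd e₂ : ℝ) * |∑ m ∈ M, _| ≤ (e₁.gcd e₂ : ℝ) *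
          ((v / e₁ : ℝ) * (v / e₂) / (selbergJ z W ^ 2 * v.totient ^ 2) * selbergJ z W) := by
          refine mul_le_mul_of_nonneg_left ?_ (Nat.cast_nonneg _)
          refine (Finset.abs_sum_le_sum_abs _ _).trans ((Finset.sum_le_sum h2).trans ?_)
          rw [← Finset.sum_filter, ← Finset.mul_sum]
          refine mul_le_mul_of_nonneg_left ?_ (by positivity)
          rw [selbergJ]
          exact Finset.sum_le_sum_of_subset_of_nonneg
            (Finset.filter_subset_filter _ (Finset.filter_subset _ _)) fun _ _ _ => by positivity
      _ = ((e₁.gcd e₂ : ℝ) * v) * v / (e₁ * e₂) / (selbergJ z W * v.totient ^ 2) := by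
          field_simp
      _ = B := by
          rw [hg, hB]
          field_simp
  rw [lcmCoeff_eq hv]
  calc _ ≤ ∑ e₁ ∈ v.divisors, ∑ e₂ ∈ v.divisors, B :=
        (Finset.abs_sum_le_sum_abs _ _).trans (Finset.sum_le_sum fun e₁ h₁ =>
          (Finset.abs_sum_le_sum_abs _ _).trans (Finset.sum_le_sum fun e₂ h₂ => h1 e₁ h₁ e₂ h₂))
    _ = (v.divisors.card : ℝ) ^ 2 * (v / v.totient) ^ 2 / (v * selbergJ z W) := by
        simp only [Finset.sum_const, nsmul_eq_mul, hB]
        field_simp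
    _ ≤ (v.divisors.card : ℝ) ^ 2 * (v.divisors.card : ℝ) ^ 2 / (v * selbergJ z W) := by
        gcongr
        exact div_totient_le_card_divisors v
    _ = _ := by ring

/-! ### The asymptotics of the normalising sum -/

/-- The natural numbers below `z` that are coprime to `W`. -/
noncomputable def coprimesBelow (W : ℕ) (z : ℝ) : Finset ℕ :=
  (Finset.range ⌈z⌉₊).filter (fun m => m.Coprime W)

theorem mem_coprimesBelow {W m : ℕ} {z : ℝ} :
    m ∈ coprimesBelow W z ↔ (m : ℝ) < z ∧ m.Coprime W := by
  rw [coprimesBelow, Finset.mem_filter, Finset.mem_range, Nat.lt_ceil]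

/-- `∑ 1 / φ(d)` over the squarefree `d < z` coprime to `W`. -/
noncomputable def totientSum (W : ℕ) (z : ℝ) : ℝ :=
  ∑ d ∈ (coprimesBelow W z).filter Squarefree, 1 / (d.totient : ℝ)

/-- `∑ 1 / m` over the `m < z` coprime to `W`. -/
noncomputable def coprimeHarmonic (W : ℕ) (z : ℝ) : ℝ :=
  ∑ m ∈ coprimesBelow W z, 1 / (m : ℝ)

theorem dvd_selbergP_iff {z : ℝ} {W d : ℕ} (hdz : (d : ℝ) < z) :
    d ∣ selbergP z W ↔ Squarefree d ∧ d.Coprime W := by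
  constructor
  · intro h
    refine ⟨(selbergP_squarefree z W).squarefree_of_dvd h, Nat.Coprime.coprime_dvd_left h ?_⟩
    exact Nat.Coprime.prod_left fun p hp => (Finset.mem_filter.1 hp).2.2
  · rintro ⟨h1, h2⟩
    rw [← Nat.prod_primeFactors_of_squarefree h1]
    refine Finset.prod_dvd_prod_of_subset _ _ _ fun p hp => ?_
    have hpd := Nat.dvd_of_mem_primeFactors hp
    refine Finset.mem_filter.2 ⟨Finset.mem_range.2 (Nat.lt_ceil.2 (lt_of_le_of_lt ?_ hdz)),
      Nat.prime_of_mem_primeFactors hp, h2.coprime_dvd_left hpd⟩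
    exact_mod_cast Nat.le_of_dvd (Nat.pos_of_ne_zero h1.ne_zero) hpd

theorem selbergJ_eq_totientSum (z : ℝ) (W : ℕ) : selbergJ z W = totientSum W z := by
  refine Finset.sum_congr ?_ fun _ _ => rfl
  ext d
  simp only [Finset.mem_filter, Nat.mem_divisors, mem_coprimesBelow]
  constructor
  · rintro ⟨⟨h1, -⟩, h2⟩
    have := (dvd_selbergP_iff h2).1 h1
    tauto
  · rintro ⟨⟨h1, h2⟩, h3⟩
    exact ⟨⟨(dvd_selbergP_iff h1).2 ⟨h3, h2⟩, selbergP_ne_zero z W⟩, h1⟩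

theorem coprimeHarmonic_nonneg (W : ℕ) (z : ℝ) : 0 ≤ coprimeHarmonic W z :=
  Finset.sum_nonneg fun _ _ => by positivity

theorem totientSum_mono (W : ℕ) {z z' : ℝ} (h : z ≤ z') : totientSum W z ≤ totientSum W z' := by
  refine Finset.sum_le_sum_of_subset_of_nonneg (Finset.filter_subset_filter _ fun m hm => ?_)
    fun _ _ _ => by positivity
  rw [mem_coprimesBelow] at hm ⊢
  exact ⟨hm.1.trans_le h, hm.2⟩

/-- Split the squarefree d according to whether p divides d, and write d = pk in the second case.
This permits adjoining primes to W. -/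
theorem totientSum_eq_add {W p : ℕ} (hp : p.Prime) (hpW : ¬ p ∣ W) (z : ℝ) :
    totientSum W z = totientSum (W * p) z + 1 / ((p : ℝ) - 1) * totientSum (W * p) (z / p) := by
  have hp0 : (0 : ℝ) < p := by exact_mod_cast hp.pos
  have hcopW : p.Coprime W := (Nat.Prime.coprime_iff_not_dvd hp).2 hpW
  rw [totientSum, ← Finset.sum_filter_not_add_sum_filter _ (fun d => p ∣ d)]
  congr 1
  · refine Finset.sum_congr ?_ fun _ _ => rfl
    ext d
    simp only [Finset.mem_filter, mem_coprimesBelow, Nat.coprime_mul_iff_right]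
    rw [← Nat.Prime.coprime_iff_not_dvd hp, Nat.coprime_comm (m := p)]
    tauto
  · rw [totientSum, Finset.mul_sum]
    symm
    refine Finset.sum_bij (fun d _ => p * d) ?_ ?_ ?_ ?_
    · intro d hd
      simp only [Finset.mem_filter, mem_coprimesBelow, Nat.coprime_mul_iff_right] at hd ⊢
      obtain ⟨⟨h1, h2, h3⟩, h4⟩ := hd
      refine ⟨⟨⟨?_, Nat.Coprime.mul_left hcopW h2⟩, ?_⟩, Dvd.intro _ rfl⟩
      · rw [lt_div_iff₀ hp0] at h1
        push_cast
        linarith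
      · exact (Nat.squarefree_mul h3.symm).2 ⟨hp.squarefree, h4⟩
    · intro d _ d' _ h
      exact Nat.eq_of_mul_eq_mul_left hp.pos h
    · intro d hd
      simp only [Finset.mem_filter, mem_coprimesBelow] at hd
      obtain ⟨⟨⟨h1, h2⟩, h3⟩, k, rfl⟩ := hd
      refine ⟨k, ?_, rfl⟩
      simp only [Finset.mem_filter, mem_coprimesBelow, Nat.coprime_mul_iff_right]
      refine ⟨⟨?_, h2.coprime_dvd_left (Dvd.intro_left _ rfl),
        (Nat.coprime_of_squarefree_mul h3).symm⟩, h3.squarefree_of_dvd (Dvd.intro_left _ rfl)⟩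
      rw [lt_div_iff₀ hp0]
      push_cast at h1
      linarith
    · intro d hd
      simp only [Finset.mem_filter, mem_coprimesBelow, Nat.coprime_mul_iff_right] at hd
      rw [Nat.totient_mul hd.1.2.2.symm, Nat.totient_prime hp, Nat.cast_mul,
        Nat.cast_sub hp.one_le, Nat.cast_one, one_div_mul_one_div]

/-- Sums over blocks of `W` consecutive integers. -/
theorem sum_range_mul_succ_coprime (W J : ℕ) :
    ∑ m ∈ (Finset.range ((J + 1) * W)).filter (fun m => m.Coprime W), 1 / (m : ℝ) =
      ∑ m ∈ (Finset.range (J * W)).filter (fun m => m.Coprime W), 1 / (m : ℝ) +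
      ∑ m ∈ (Finset.Ico (J * W) (J * W + W)).filter (fun m => m.Coprime W), 1 / (m : ℝ) := by
  rw [← Finset.sum_union, ← Finset.filter_union]
  · rw [add_mul, one_mul, Finset.range_eq_Ico, Finset.range_eq_Ico,
      Finset.Ico_union_Ico_eq_Ico (Nat.zero_le _) (Nat.le_add_right _ _)]
  · refine Finset.disjoint_filter_filter ?_
    rw [Finset.range_eq_Ico]
    exact Finset.Ico_disjoint_Ico_consecutive _ _ _

theorem card_coprime_Ico (W a : ℕ) :
    (((Finset.Ico a (a + W)).filter (fun m => m.Coprime W)).card : ℝ) = W.totient := by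
  rw [← Nat.filter_coprime_Ico_eq_totient W a]
  simp only [Nat.coprime_comm]

theorem sum_range_mul_succ_coprime_le {W : ℕ} (hW : 0 < W) (J : ℕ) :
    ∑ m ∈ (Finset.range ((J + 1) * W)).filter (fun m => m.Coprime W), 1 / (m : ℝ) ≤
      W + (W.totient : ℝ) / W * (harmonic J : ℚ) := by
  have hW' : (0 : ℝ) < W := by exact_mod_cast hW
  induction J with
  | zero =>
    rw [zero_add, one_mul, harmonic_zero, Rat.cast_zero, mul_zero, add_zero]
    calc _ ≤ ∑ m ∈ (Finset.range W).filter (fun m => m.Coprime W), (1 : ℝ) := by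
          refine Finset.sum_le_sum fun m _ => ?_
          rw [one_div]
          exact Nat.cast_inv_le_one m
      _ ≤ ∑ m ∈ Finset.range W, (1 : ℝ) := Finset.sum_le_sum_of_subset_of_nonneg
          (Finset.filter_subset _ _) fun _ _ _ => zero_le_one
      _ = W := by simp
  | succ J ih =>
    rw [sum_range_mul_succ_coprime, harmonic_succ]
    have h1 : ∑ m ∈ (Finset.Ico ((J + 1) * W) ((J + 1) * W + W)).filter (fun m => m.Coprime W),
        1 / (m : ℝ) ≤ W.totient * (1 / ((J + 1 : ℕ) * W)) := by
      rw [← card_coprime_Ico W ((J + 1) * W), ← nsmul_eq_mul]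
      refine Finset.sum_le_card_nsmul _ _ _ fun m hm => ?_
      have : (J + 1) * W ≤ m := (Finset.mem_Ico.1 (Finset.mem_filter.1 hm).1).1
      refine one_div_le_one_div_of_le (by positivity) ?_
      exact_mod_cast this
    refine (add_le_add ih h1).trans (le_of_eq ?_)
    push_cast
    field_simp
    ring

theorem le_sum_range_mul_coprime {W : ℕ} (hW : 1 < W) (J : ℕ) :
    (W.totient : ℝ) / W * (harmonic J : ℚ) ≤
      ∑ m ∈ (Finset.range (J * W)).filter (fun m => m.Coprime W), 1 / (m : ℝ) := by
  have hW' : (0 : ℝ) < W := by exact_mod_cast zero_lt_one.trans hW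
  induction J with
  | zero => simp
  | succ J ih =>
    rw [sum_range_mul_succ_coprime, harmonic_succ]
    have h1 : W.totient * (1 / ((J + 1 : ℕ) * W)) ≤
        ∑ m ∈ (Finset.Ico (J * W) (J * W + W)).filter (fun m => m.Coprime W), 1 / (m : ℝ) := by
      rw [← card_coprime_Ico W (J * W), ← nsmul_eq_mul]
      refine Finset.card_nsmul_le_sum _ _ _ fun m hm => ?_
      obtain ⟨h2, h3⟩ := Finset.mem_filter.1 hm
      have h4 := (Finset.mem_Ico.1 h2).2
      -- Since W > 1, the number 0 is not coprime to W; otherwise its term 1/0 = 0 would break the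
      -- lower bound in the first block.
      have h5 : 0 < m := by
        rcases Nat.eq_zero_or_pos m with rfl | h
        · simp at h3; omega
        · exact h
      refine one_div_le_one_div_of_le (by positivity) ?_
      have : m ≤ (J + 1) * W := by rw [add_mul]; omega
      exact_mod_cast this
    refine le_trans (le_of_eq ?_) (add_le_add ih h1)
    push_cast
    field_simp

theorem coprimeHarmonic_le {W : ℕ} (hW : 0 < W) {z : ℝ} (hz : 1 ≤ z) :
    coprimeHarmonic W z ≤ (W.totient : ℝ) / W * Real.log z + (W + 1) := by
  have hW' : (0 : ℝ) < W := by exact_mod_cast hW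
  have hW1 : (1 : ℝ) ≤ W := by exact_mod_cast hW
  have hφ : (W.totient : ℝ) / W ≤ 1 := by
    rw [div_le_one hW']
    exact_mod_cast Nat.totient_le W
  have hφ0 : 0 ≤ (W.totient : ℝ) / W := by positivity
  have hl : 0 ≤ Real.log z := Real.log_nonneg hz
  have h1 : coprimeHarmonic W z ≤
      ∑ m ∈ (Finset.range ((⌊z / W⌋₊ + 1) * W)).filter (fun m => m.Coprime W), 1 / (m : ℝ) := by
    refine Finset.sum_le_sum_of_subset_of_nonneg (fun m hm => ?_) fun _ _ _ => by positivity
    obtain ⟨h1, h2⟩ := mem_coprimesBelow.1 hm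
    refine Finset.mem_filter.2 ⟨Finset.mem_range.2 ?_, h2⟩
    have h3 := Nat.lt_floor_add_one (z / W)
    rw [div_lt_iff₀ hW'] at h3
    exact_mod_cast h1.trans h3
  refine (h1.trans (sum_range_mul_succ_coprime_le hW _)).trans ?_
  rcases le_or_gt 1 (z / W) with h | h
  · have h2 := harmonic_floor_le_one_add_log _ h
    rw [Real.log_div (by positivity) hW'.ne'] at h2
    have h3 : 0 ≤ Real.log W := Real.log_nonneg hW1
    have h4 : ((harmonic ⌊z / W⌋₊ : ℚ) : ℝ) ≤ 1 + Real.log z := by linarith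
    nlinarith [mul_le_mul_of_nonneg_left h4 hφ0]
  · rw [Nat.floor_eq_zero.2 h]
    simp only [harmonic_zero, Rat.cast_zero, mul_zero, add_zero]
    nlinarith [mul_nonneg hφ0 hl]

theorem le_coprimeHarmonic {W : ℕ} (hW : 1 < W) {z : ℝ} (hz : 0 < z) :
    (W.totient : ℝ) / W * (Real.log z - Real.log W) ≤ coprimeHarmonic W z := by
  have hW' : (0 : ℝ) < W := by exact_mod_cast zero_lt_one.trans hW
  rw [← Real.log_div hz.ne' hW'.ne']
  refine (mul_le_mul_of_nonneg_left (log_le_harmonic_floor _ (by positivity)) (by positivity)).trans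
    ((le_sum_range_mul_coprime hW _).trans ?_)
  refine Finset.sum_le_sum_of_subset_of_nonneg (fun m hm => ?_) fun _ _ _ => by positivity
  obtain ⟨h1, h2⟩ := Finset.mem_filter.1 hm
  refine mem_coprimesBelow.2 ⟨?_, h2⟩
  have h3 := Nat.floor_le (show 0 ≤ z / W by positivity)
  rw [le_div_iff₀ hW'] at h3
  refine lt_of_lt_of_le ?_ h3
  exact_mod_cast Finset.mem_range.1 h1

theorem sum_multiples_le (W k : ℕ) (z : ℝ) :
    ∑ m ∈ (coprimesBelow W z).filter (fun m => k ∣ m), 1 / (m : ℝ) ≤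
      1 / (k : ℝ) * coprimeHarmonic W z := by
  rcases Nat.eq_zero_or_pos k with rfl | hk
  · refine le_of_eq ?_
    rw [Nat.cast_zero, div_zero, zero_mul]
    refine Finset.sum_eq_zero fun m hm => ?_
    rw [Nat.eq_zero_of_zero_dvd (Finset.mem_filter.1 hm).2]
    simp
  have h1 : ∀ m ∈ (coprimesBelow W z).filter (fun m => k ∣ m), 1 / (m : ℝ) =
      1 / (k : ℝ) * (1 / ((m / k : ℕ) : ℝ)) := by
    intro m hm
    obtain ⟨-, j, rfl⟩ := Finset.mem_filter.1 hm
    rw [Nat.mul_div_cancel_left _ hk, one_div_mul_one_div, Nat.cast_mul]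
  rw [Finset.sum_congr rfl h1, ← Finset.mul_sum]
  refine mul_le_mul_of_nonneg_left ?_ (by positivity)
  rw [← Finset.sum_image (g := fun m => m / k) (f := fun m : ℕ => 1 / (m : ℝ))]
  · refine Finset.sum_le_sum_of_subset_of_nonneg (fun j hj => ?_) (fun _ _ _ => by positivity)
    obtain ⟨m, hm, rfl⟩ := Finset.mem_image.1 hj
    obtain ⟨h1, h2⟩ := Finset.mem_filter.1 hm
    obtain ⟨h3, h4⟩ := mem_coprimesBelow.1 h1
    refine mem_coprimesBelow.2 ⟨lt_of_le_of_lt ?_ h3, h4.coprime_dvd_left (Nat.div_dvd_of_dvd h2)⟩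
    exact_mod_cast Nat.div_le_self m k
  · intro m hm m' hm' h
    rw [← Nat.mul_div_cancel' (Finset.mem_filter.1 hm).2,
      ← Nat.mul_div_cancel' (Finset.mem_filter.1 hm').2]
    exact congrArg (k * ·) h

/-- The series ∑ τ(n)/n² converges, as τ(n) = O(n^(1/2)). Its tail dominates both corrections that
separate 1/φ(d) over squarefree d from 1/m over all m. -/
theorem exists_tail_card_divisors_le {ε : ℝ} (hε : 0 < ε) :
    ∃ y : ℕ, ∀ s : Finset ℕ, (∀ n ∈ s, y ≤ n) →
      ∑ n ∈ s, (n.divisors.card : ℝ) / (n : ℝ) ^ 2 ≤ ε := by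
  obtain ⟨C, hC, hdiv⟩ := exists_card_divisors_le_rpow (η := 1 / 2) (by norm_num)
  have hs : Summable fun n : ℕ => (n.divisors.card : ℝ) / (n : ℝ) ^ 2 := by
    refine Summable.of_nonneg_of_le (fun n => by positivity) (fun n => ?_)
      ((Real.summable_one_div_nat_rpow (p := 3 / 2)).2 (by norm_num) |>.mul_left C)
    rcases Nat.eq_zero_or_pos n with rfl | hn
    · simp [Real.zero_rpow]
    have hn' : (0 : ℝ) < n := by exact_mod_cast hn
    rw [mul_one_div, div_le_div_iff₀ (by positivity) (by positivity)]
    have h1 : (n : ℝ) ^ 2 = (n : ℝ) ^ (1 / 2 : ℝ) * (n : ℝ) ^ (3 / 2 : ℝ) := by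
      rw [← Real.rpow_add hn', ← Real.rpow_natCast]
      norm_num
    rw [h1, ← mul_assoc]
    gcongr
    exact hdiv n
  obtain ⟨s₀, h0⟩ := summable_iff_vanishing_norm.1 hs ε hε
  refine ⟨s₀.sup id + 1, fun s h => ?_⟩
  refine (le_abs_self _).trans (h0 s ?_).le
  rw [Finset.disjoint_left]
  intro n hn hn'
  have := h n hn
  have : n ≤ s₀.sup id := Finset.le_sup (f := id) hn'
  omega

theorem le_of_coprime {W y m : ℕ} (hW : ∀ p, p.Prime → p < y → p ∣ W) (hm : m.Coprime W)
    (h0 : m ≠ 0) (h1 : m ≠ 1) : y ≤ m := by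
  by_contra h
  have hp := Nat.minFac_prime h1
  have h2 : m.minFac < y := lt_of_le_of_lt (Nat.minFac_le (Nat.pos_of_ne_zero h0)) (not_le.1 h)
  have h3 := Nat.dvd_gcd (Nat.minFac_dvd m) (hW _ hp h2)
  rw [hm.gcd_eq_one] at h3
  exact hp.one_lt.ne' (Nat.dvd_one.1 h3)

/-- Write 1/φ(d) = (1/d) ∑_{f ∣ d} 1/φ(f) and sum over d first: each f contributes at most 1/(f
φ(f)) times the harmonic sum. The term f = 1 gives 1, and every other f coprime to W is at least y.
-/
theorem totientSum_le_mul_coprimeHarmonic {W y : ℕ} {ε : ℝ}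
    (hy : ∀ s : Finset ℕ, (∀ n ∈ s, y ≤ n) →
      ∑ n ∈ s, (n.divisors.card : ℝ) / (n : ℝ) ^ 2 ≤ ε)
    (hW : ∀ p, p.Prime → p < y → p ∣ W) (z : ℝ) :
    totientSum W z ≤ (1 + ε) * coprimeHarmonic W z := by
  have hK := coprimeHarmonic_nonneg W z
  set A := coprimesBelow W z with hA
  have h1 : ∀ d ∈ A.filter Squarefree, 1 / (d.totient : ℝ) =
      ∑ f ∈ d.divisors, 1 / (f.totient : ℝ) * (1 / (d : ℝ)) := by
    intro d hd
    have hs := (Finset.mem_filter.1 hd).2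
    have := Nat.pos_of_ne_zero hs.ne_zero
    rw [← Finset.sum_mul, sum_one_div_totient_divisors hs]
    field_simp
  have h2 : ∀ f ∈ A.erase 0, ∑ d ∈ (A.filter Squarefree).filter (fun d => f ∣ d),
      1 / (f.totient : ℝ) * (1 / (d : ℝ)) ≤
        1 / ((f : ℝ) * f.totient) * coprimeHarmonic W z := by
    intro f _
    rw [← Finset.mul_sum, mul_comm (f : ℝ), ← one_div_mul_one_div, mul_assoc]
    refine mul_le_mul_of_nonneg_left (le_trans ?_ (sum_multiples_le W f z)) (by positivity)
    exact Finset.sum_le_sum_of_subset_of_nonneg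
      (Finset.filter_subset_filter _ (Finset.filter_subset _ _)) fun _ _ _ => by positivity
  have h3 : ∑ f ∈ A.erase 0, 1 / ((f : ℝ) * f.totient) ≤ 1 + ε := by
    have h4 : ∑ f ∈ (A.erase 0).erase 1, 1 / ((f : ℝ) * f.totient) ≤ ε := by
      refine le_trans (Finset.sum_le_sum fun f hf => ?_) (hy ((A.erase 0).erase 1) fun n hn => ?_)
      · have hf0 : 0 < f := Nat.pos_of_ne_zero (Finset.mem_erase.1 (Finset.mem_erase.1 hf).2).1
        have hf0' : (0 : ℝ) < f := by exact_mod_cast hf0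
        have hφ := Nat.totient_pos.2 hf0
        have := div_totient_le_card_divisors f
        calc 1 / ((f : ℝ) * f.totient) = (f / f.totient) / (f : ℝ) ^ 2 := by field_simp
          _ ≤ _ := by gcongr
      · obtain ⟨k1, k2⟩ := Finset.mem_erase.1 hn
        obtain ⟨k2, k3⟩ := Finset.mem_erase.1 k2
        exact le_of_coprime hW (mem_coprimesBelow.1 k3).2 k2 k1
    by_cases h : 1 ∈ A.erase 0
    · rw [← Finset.add_sum_erase _ _ h]
      simpa using h4
    · rw [Finset.erase_eq_of_notMem h] at h4
      linarith
  rw [totientSum, Finset.sum_congr rfl h1, Finset.sum_comm' (t' := A.erase 0)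
    (s' := fun f => (A.filter Squarefree).filter (fun d => f ∣ d))]
  · refine (Finset.sum_le_sum h2).trans ?_
    rw [← Finset.sum_mul]
    exact mul_le_mul_of_nonneg_right h3 hK
  · intro d f
    simp only [Finset.mem_filter, Nat.mem_divisors, Finset.mem_erase, hA, mem_coprimesBelow]
    constructor
    · rintro ⟨⟨⟨k1, k2⟩, k3⟩, k4, k5⟩
      refine ⟨⟨⟨⟨k1, k2⟩, k3⟩, k4⟩, fun h => k5 (Nat.eq_zero_of_zero_dvd (h ▸ k4)),
        lt_of_le_of_lt ?_ k1, k2.coprime_dvd_left k4⟩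
      exact_mod_cast Nat.le_of_dvd (Nat.pos_of_ne_zero k5) k4
    · rintro ⟨⟨⟨⟨k1, k2⟩, k3⟩, k4⟩, -⟩
      exact ⟨⟨⟨k1, k2⟩, k3⟩, k4, k3.ne_zero⟩

/-- Since 1/φ(d) ≥ 1/d, only the m that are not squarefree are lost. They are multiples of p² for
primes p ≥ y, hence account for at most ∑ 1/p² of the harmonic sum. -/
theorem mul_coprimeHarmonic_le_totientSum {W y : ℕ} {ε : ℝ}
    (hy : ∀ s : Finset ℕ, (∀ n ∈ s, y ≤ n) →
      ∑ n ∈ s, (n.divisors.card : ℝ) / (n : ℝ) ^ 2 ≤ ε)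
    (hW : ∀ p, p.Prime → p < y → p ∣ W) (z : ℝ) :
    (1 - ε) * coprimeHarmonic W z ≤ totientSum W z := by
  have hK := coprimeHarmonic_nonneg W z
  set A := coprimesBelow W z with hA
  set B := A.filter Nat.Prime with hB
  have h1 : ∑ m ∈ A.filter Squarefree, 1 / (m : ℝ) ≤ totientSum W z := by
    refine Finset.sum_le_sum fun d hd => ?_
    have := Nat.pos_of_ne_zero (Finset.mem_filter.1 hd).2.ne_zero
    have := Nat.totient_pos.2 this
    refine one_div_le_one_div_of_le (by positivity) ?_
    exact_mod_cast Nat.totient_le d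
  have h2 : ∑ m ∈ A.filter (fun m => ¬ Squarefree m), 1 / (m : ℝ) ≤
      ∑ p ∈ B, ∑ m ∈ A.filter (fun m => p ^ 2 ∣ m), 1 / (m : ℝ) := by
    have h3 : ∀ m ∈ A.filter (fun m => ¬ Squarefree m), 1 / (m : ℝ) ≤
        ∑ p ∈ B, if p ^ 2 ∣ m then 1 / (m : ℝ) else 0 := by
      intro m hm
      obtain ⟨k1, k2⟩ := Finset.mem_filter.1 hm
      obtain ⟨k3, k4⟩ := mem_coprimesBelow.1 k1
      rcases Nat.eq_zero_or_pos m with rfl | hm0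
      · simp
      rw [Nat.squarefree_iff_prime_squarefree] at k2
      push Not at k2
      obtain ⟨p, hp, hpm⟩ := k2
      have hpm' : p ∣ m := (Dvd.intro _ rfl).trans hpm
      have hpB : p ∈ B := by
        refine Finset.mem_filter.2 ⟨mem_coprimesBelow.2 ⟨lt_of_le_of_lt ?_ k3,
          k4.coprime_dvd_left hpm'⟩, hp⟩
        exact_mod_cast Nat.le_of_dvd hm0 hpm'
      refine le_trans (le_of_eq ?_) (Finset.single_le_sum (f := fun p => if p ^ 2 ∣ m then
        1 / (m : ℝ) else 0) (fun q _ => ?_) hpB)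
      · simp only [sq, hpm, if_true]
      · split_ifs <;> positivity
    refine (Finset.sum_le_sum h3).trans ?_
    rw [Finset.sum_comm]
    refine Finset.sum_le_sum fun p _ => ?_
    rw [← Finset.sum_filter]
    exact Finset.sum_le_sum_of_subset_of_nonneg
      (Finset.filter_subset_filter _ (Finset.filter_subset _ _)) fun _ _ _ => by positivity
  have h4 : ∑ p ∈ B, ∑ m ∈ A.filter (fun m => p ^ 2 ∣ m), 1 / (m : ℝ) ≤
      ε * coprimeHarmonic W z := by
    calc _ ≤ ∑ p ∈ B, (p.divisors.card : ℝ) / (p : ℝ) ^ 2 * coprimeHarmonic W z := by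
          refine Finset.sum_le_sum fun p hp => (sum_multiples_le W (p ^ 2) z).trans ?_
          have h5 : (1 : ℝ) ≤ p.divisors.card := by
            exact_mod_cast Finset.card_pos.2 (Nat.nonempty_divisors.2
              (Finset.mem_filter.1 hp).2.ne_zero)
          push_cast
          gcongr
      _ ≤ _ := by
          rw [← Finset.sum_mul]
          refine mul_le_mul_of_nonneg_right (hy B fun p hp => ?_) hK
          obtain ⟨k1, k2⟩ := Finset.mem_filter.1 hp
          exact le_of_coprime hW (mem_coprimesBelow.1 k1).2 k2.ne_zero k2.one_lt.ne'
  have h5 : coprimeHarmonic W z = ∑ m ∈ A.filter Squarefree, 1 / (m : ℝ) +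
      ∑ m ∈ A.filter (fun m => ¬ Squarefree m), 1 / (m : ℝ) :=
    (Finset.sum_filter_add_sum_filter_not _ _ _).symm
  linarith

/-- Missing primes below y are adjoined to W one at a time until all of them divide it, which is the
case that compares directly with a harmonic sum. -/
theorem induction_on_primes_dvd {Q : ℕ → Prop} {y : ℕ}
    (hbase : ∀ W, 1 < W → (∀ p, p.Prime → p < y → p ∣ W) → Q W)
    (hstep : ∀ W p, 1 < W → p.Prime → ¬ p ∣ W → Q (W * p) → Q W) :
    ∀ W, 1 < W → Q W := by
  suffices h : ∀ t ≤ y, ∀ W, 1 < W → (∀ p, p.Prime → p < y - t → p ∣ W) → Q W from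
    fun W hW => h y le_rfl W hW fun p _ hp => by omega
  intro t
  induction t with
  | zero => exact fun _ => hbase
  | succ t ih =>
    intro ht W hW h
    by_cases hp : (y - (t + 1)).Prime ∧ ¬ (y - (t + 1)) ∣ W
    · refine hstep W _ hW hp.1 hp.2 (ih (by omega) _ ?_ fun p hpp hpy => ?_)
      · exact hW.trans_le (Nat.le_mul_of_pos_right _ hp.1.pos)
      · rcases eq_or_ne p (y - (t + 1)) with rfl | hne
        · exact Dvd.intro_left _ rfl
        · exact (h p hpp (by omega)).mul_right _
    · refine ih (by omega) W hW fun p hpp hpy => ?_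
      rcases eq_or_ne p (y - (t + 1)) with rfl | hne
      · by_contra h'
        exact hp ⟨hpp, h'⟩
      · exact h p hpp (by omega)

theorem totient_div_mul_prime {W p : ℕ} (hp : p.Prime) (hpW : ¬ p ∣ W) :
    ((W * p).totient : ℝ) / (W * p : ℕ) * (1 + 1 / ((p : ℝ) - 1)) = (W.totient : ℝ) / W := by
  have hp1 : (1 : ℝ) < p := by exact_mod_cast hp.one_lt
  have hp1' : (p : ℝ) - 1 ≠ 0 := by linarith
  have hp0 : (p : ℝ) ≠ 0 := by linarith
  rw [Nat.totient_mul ((Nat.Prime.coprime_iff_not_dvd hp).2 hpW).symm, Nat.totient_prime hp]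
  push_cast [hp.one_le]
  field_simp
  ring

theorem exists_totientSum_le {ε : ℝ} (hε : 0 < ε) : ∀ W : ℕ, 1 < W → ∃ K : ℝ, ∀ z : ℝ, 1 ≤ z →
    totientSum W z ≤ (1 + ε) * ((W.totient : ℝ) / W) * Real.log z + K := by
  obtain ⟨y, hy⟩ := exists_tail_card_divisors_le hε
  refine induction_on_primes_dvd (y := y) ?_ ?_
  · intro W hW h
    refine ⟨(1 + ε) * (W + 1), fun z hz => (totientSum_le_mul_coprimeHarmonic hy h z).trans ?_⟩
    have := mul_le_mul_of_nonneg_left (coprimeHarmonic_le (zero_lt_one.trans hW) hz)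
      (show 0 ≤ 1 + ε by linarith)
    linarith
  · rintro W p hW hp hpW ⟨K, hK⟩
    have hp1 : (1 : ℝ) < p := by exact_mod_cast hp.one_lt
    have hp1' : 0 ≤ 1 / ((p : ℝ) - 1) := one_div_nonneg.2 (by linarith)
    refine ⟨K * (1 + 1 / ((p : ℝ) - 1)), fun z hz => ?_⟩
    -- Replacing z/p by z only increases the sum, and the factor 1 + 1/(p-1) is exactly the ratio of
    -- the two totient densities, so the leading coefficient is preserved.
    have h1 : totientSum (W * p) (z / p) ≤ totientSum (W * p) z :=
      totientSum_mono _ (div_le_self (by linarith) hp1.le)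
    rw [totientSum_eq_add hp hpW, ← totient_div_mul_prime hp hpW]
    have h2 := mul_le_mul_of_nonneg_left h1 hp1'
    have h3 := mul_le_mul_of_nonneg_right (hK z hz) (show 0 ≤ 1 + 1 / ((p : ℝ) - 1) by linarith)
    linarith

/-- Dually to the upper bound, both terms of the splitting are bounded below at z/p, at the cost of
a multiple of log p in the constant. All z > 0 are allowed because z/p may be below 1. -/
theorem exists_le_totientSum {ε : ℝ} (hε : 0 < ε) (hε1 : ε < 1) : ∀ W : ℕ, 1 < W → ∃ K : ℝ,
    ∀ z : ℝ, 0 < z →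
      (1 - ε) * ((W.totient : ℝ) / W) * Real.log z - K ≤ totientSum W z := by
  obtain ⟨y, hy⟩ := exists_tail_card_divisors_le hε
  refine induction_on_primes_dvd (y := y) ?_ ?_
  · intro W hW h
    refine ⟨(1 - ε) * ((W.totient : ℝ) / W) * Real.log W, fun z hz =>
      le_trans ?_ (mul_coprimeHarmonic_le_totientSum hy h z)⟩
    have := mul_le_mul_of_nonneg_left (le_coprimeHarmonic hW hz)
      (show 0 ≤ 1 - ε by linarith)
    linarith
  · rintro W p hW hp hpW ⟨K, hK⟩
    have hp1 : (1 : ℝ) < p := by exact_mod_cast hp.one_lt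
    have hp0 : (0 : ℝ) < p := by linarith
    have hp1' : 0 ≤ 1 / ((p : ℝ) - 1) := one_div_nonneg.2 (by linarith)
    set c := (1 - ε) * (((W * p).totient : ℝ) / (W * p : ℕ)) with hc
    refine ⟨(K + c * Real.log p) * (1 + 1 / ((p : ℝ) - 1)), fun z hz => ?_⟩
    have h1 : totientSum (W * p) (z / p) ≤ totientSum (W * p) z :=
      totientSum_mono _ (div_le_self hz.le hp1.le)
    have h2 := hK (z / p) (by positivity)
    rw [Real.log_div hz.ne' hp0.ne'] at h2
    rw [totientSum_eq_add hp hpW, ← totient_div_mul_prime hp hpW]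
    have h3 := mul_le_mul_of_nonneg_left h2 hp1'
    nlinarith [h3, h2, h1]

/-- `J` is asymptotic to `(φ(W) / W) log z`. -/
theorem tendsto_log_div_selbergJ {W : ℕ} (hW : 1 < W) :
    Filter.Tendsto (fun z : ℝ => (W.totient : ℝ) / W * Real.log z * (selbergJ z W)⁻¹)
      Filter.atTop (nhds 1) := by
  rw [Metric.tendsto_atTop]
  intro η hη
  have hW0 : 0 < W := zero_lt_one.trans hW
  have hc : 0 < (W.totient : ℝ) / W := by
    have := Nat.totient_pos.2 hW0
    positivity
  set c := (W.totient : ℝ) / W with hcdef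
  -- Once the constants K₁, K₂ are at most εx, with x = c log z, one gets |x - J| ≤ 2εx ≤ 4εJ ≤
  -- ηJ/2.
  set ε := min η 1 / 8 with hεdef
  have hε : 0 < ε := by positivity
  have hε1 : ε ≤ 1 / 8 := by rw [hεdef]; gcongr; exact min_le_right _ _
  have hεη : ε * 8 ≤ η := by rw [hεdef]; linarith [min_le_left η 1]
  obtain ⟨K₁, hK₁⟩ := exists_totientSum_le hε W hW
  obtain ⟨K₂, hK₂⟩ := exists_le_totientSum hε (by linarith) W hW
  obtain ⟨Z, hZ⟩ := Filter.eventually_atTop.1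
    (Real.tendsto_log_atTop.eventually_ge_atTop (max (max K₁ K₂) 1 / (ε * c)))
  refine ⟨max Z 2, fun z hz => ?_⟩
  have hz2 : 2 ≤ z := (le_max_right _ _).trans hz
  have hl := hZ z ((le_max_left _ _).trans hz)
  rw [div_le_iff₀ (by positivity)] at hl
  have h1 := hK₁ z (by linarith)
  have h2 := hK₂ z (by linarith)
  have hm1 := le_max_left K₁ K₂
  have hm2 := le_max_right K₁ K₂
  have hm3 := le_max_left (max K₁ K₂) 1
  have hm4 := le_max_right (max K₁ K₂) 1
  have hJ := selbergJ_pos (show 1 < z by linarith) W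
  rw [← selbergJ_eq_totientSum] at h1 h2
  set J := selbergJ z W
  set x := c * Real.log z with hx
  have hlx : Real.log z * (ε * c) = ε * x := by rw [hx]; ring
  rw [hlx] at hl
  have h1' : J ≤ (1 + 2 * ε) * x := by
    have : (1 + ε) * c * Real.log z = (1 + ε) * x := by rw [hx]; ring
    linarith
  have h2' : (1 - 2 * ε) * x ≤ J := by
    have : (1 - ε) * c * Real.log z = (1 - ε) * x := by rw [hx]; ring
    linarith
  have hx0 : 0 < x := by
    by_contra h
    nlinarith
  rw [Real.dist_eq, ← div_eq_mul_inv, div_sub_one hJ.ne', abs_div, abs_of_pos hJ,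
    div_lt_iff₀ hJ]
  have h3 : |x - J| ≤ 2 * ε * x := by
    rw [abs_le]
    constructor <;> linarith
  have h4 : x ≤ 2 * J := by nlinarith
  calc |x - J| ≤ 2 * ε * x := h3
    _ ≤ 2 * ε * (2 * J) := by gcongr
    _ < η * J := by nlinarith

/-! ### Exponential sums over arithmetic progressions -/

/-- The additive character `e(x) = exp(2 π i x)`. -/
noncomputable def expChar (x : ℝ) : ℂ := Complex.exp (2 * Real.pi * Complex.I * (x : ℝ))

theorem expChar_add (x y : ℝ) : expChar (x + y) = expChar x * expChar y := by
  rw [expChar, expChar, expChar, ← Complex.exp_add]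
  push_cast
  ring_nf

theorem expChar_eq (x : ℝ) : expChar x = Complex.exp (Complex.I * ((2 * Real.pi * x : ℝ) : ℂ)) := by
  rw [expChar]
  push_cast
  ring_nf

theorem norm_expChar (x : ℝ) : ‖expChar x‖ = 1 := by
  rw [expChar_eq, mul_comm, Complex.norm_exp_ofReal_mul_I]

theorem expChar_intCast (k : ℤ) : expChar k = 1 := by
  rw [expChar, Complex.exp_eq_one_iff]
  exact ⟨k, by push_cast; ring⟩

theorem expChar_natCast_mul (n : ℕ) (x : ℝ) : expChar (n * x) = expChar x ^ n := by
  rw [expChar, expChar, ← Complex.exp_nat_mul]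
  push_cast
  ring_nf

theorem norm_expChar_sub_one_le (x : ℝ) : ‖expChar x - 1‖ ≤ 2 * Real.pi * |x| := by
  rw [expChar_eq]
  refine Real.norm_exp_I_mul_ofReal_sub_one_le.trans (le_of_eq ?_)
  rw [Real.norm_eq_abs, abs_mul, abs_of_pos (by positivity)]

/-- |e(x) - 1| = 2 sin(π|y|) with y the signed distance to the nearest integer, and Jordan's
inequality bounds this below by 4|y|. -/
theorem le_norm_expChar_sub_one {x t : ℝ} (h : ∀ k : ℤ, t ≤ |x - k|) :
    4 * t ≤ ‖expChar x - 1‖ := by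
  set y := x - round x with hy
  have h1 : expChar x = expChar y := by
    rw [show x = y + (round x : ℤ) by rw [hy]; ring, expChar_add, expChar_intCast, mul_one]
  have h2 : |y| ≤ 1 / 2 := abs_sub_round x
  have hpi := Real.pi_pos
  rw [h1, expChar_eq, Complex.norm_exp_I_mul_ofReal_sub_one, Real.norm_eq_abs, abs_mul,
    abs_of_pos (two_pos : (0 : ℝ) < 2)]
  have h3 : |Real.sin (2 * Real.pi * y / 2)| = Real.sin (Real.pi * |y|) := by
    rw [show 2 * Real.pi * y / 2 = Real.pi * y by ring]
    rcases le_total 0 y with hy0 | hy0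
    · rw [abs_of_nonneg hy0] at h2 ⊢
      exact abs_of_nonneg (Real.sin_nonneg_of_nonneg_of_le_pi (by positivity) (by nlinarith))
    · rw [abs_of_nonpos hy0] at h2 ⊢
      rw [← abs_neg, ← Real.sin_neg, show -(Real.pi * y) = Real.pi * -y by ring]
      exact abs_of_nonneg (Real.sin_nonneg_of_nonneg_of_le_pi
        (mul_nonneg hpi.le (by linarith)) (by nlinarith))
  have h4 := Real.mul_le_sin (x := Real.pi * |y|) (by positivity) (by nlinarith)
  rw [h3]
  have h5 : 2 / Real.pi * (Real.pi * |y|) = 2 * |y| := by field_simp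
  rw [h5] at h4
  linarith [h (round x)]

theorem sum_expChar_complete {N r : ℕ} (hr : r < N) :
    ∑ n ∈ Finset.Icc 1 N, expChar (n * ((r : ℝ) / N)) = if r = 0 then (N : ℂ) else 0 := by
  have hN : (0 : ℝ) < N := by exact_mod_cast (Nat.zero_le r).trans_lt hr
  split_ifs with h
  · subst h
    have : expChar 0 = 1 := by simpa using expChar_intCast 0
    simp [this]
  · set x := expChar ((r : ℝ) / N) with hx
    have hx1 : x ≠ 1 := by
      intro hx'
      have hr0 : (0 : ℝ) < r := by exact_mod_cast Nat.pos_of_ne_zero h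
      rw [hx, expChar, Complex.exp_eq_one_iff] at hx'
      obtain ⟨k, hk⟩ := hx'
      have h2 : (2 * Real.pi * Complex.I : ℂ) ≠ 0 := Complex.two_pi_I_ne_zero
      rw [mul_comm (k : ℂ)] at hk
      have h3 := mul_left_cancel₀ h2 hk
      have h4 : (r : ℝ) / N = k := by exact_mod_cast h3
      have h5 : 0 < (r : ℝ) / N := by positivity
      have h6 : (r : ℝ) / N < 1 := by
        rw [div_lt_one hN]
        exact_mod_cast hr
      rw [h4] at h5 h6
      have h7 : (0 : ℤ) < k := by exact_mod_cast h5
      have h8 : k < 1 := by exact_mod_cast h6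
      omega
    have hxN : x ^ N = 1 := by
      rw [hx, ← expChar_natCast_mul, mul_div_cancel₀ _ hN.ne']
      exact_mod_cast expChar_intCast r
    have h1 : ∀ n ∈ Finset.Icc 1 N, expChar (n * ((r : ℝ) / N)) = x ^ n := fun n _ =>
      expChar_natCast_mul n _
    have h2 := geom_sum_eq hx1 N
    rw [hxN, sub_self, zero_div] at h2
    rw [Finset.sum_congr rfl h1, ← Finset.Ico_add_one_right_eq_Icc, Finset.sum_Ico_eq_sum_range,
      Nat.add_sub_cancel]
    simp only [pow_add, pow_one]
    rw [← Finset.mul_sum, h2, mul_zero]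

/-- The solutions `n ∈ [1, N]` of `W n + b ≡ 0` modulo `D` form an arithmetic progression. -/
theorem exists_progression {W D : ℕ} (hD : 0 < D) (hWD : D.Coprime W) (b : ℤ) (N : ℕ) :
    ∃ c M : ℕ, 1 ≤ c ∧ c ≤ D ∧ (D : ℤ) ∣ W * c + b ∧ c + D * M ≤ N + D ∧ N < c + D * M ∧
      ∀ f : ℕ → ℂ, ∑ n ∈ (Finset.Icc 1 N).filter (fun n : ℕ => (D : ℤ) ∣ (W : ℤ) * n + b), f n =
        ∑ m ∈ Finset.range M, f (c + D * m) := by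
  have hDz : (0 : ℤ) < D := by exact_mod_cast hD
  obtain ⟨u, v, huv⟩ := Nat.isCoprime_iff_coprime.2 hWD
  -- As uD + vW = 1, the integer -bv is a solution. Shifting by 1 around the reduction modulo D
  -- picks its representative in [1, D] instead of [0, D - 1].
  obtain ⟨c, hc⟩ : ∃ c : ℕ, (c : ℤ) = (-(b * v) - 1) % D + 1 :=
    ⟨((-(b * v) - 1) % D + 1).toNat, Int.toNat_of_nonneg
      (by have := Int.emod_nonneg (-(b * v) - 1) hDz.ne'; omega)⟩
  have hc1 : 1 ≤ c := by
    have := Int.emod_nonneg (-(b * v) - 1) hDz.ne'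
    omega
  have hcD : c ≤ D := by
    have := Int.emod_lt_of_pos (-(b * v) - 1) hDz
    omega
  have hdvd : (D : ℤ) ∣ W * c + b := by
    have h1 : (-(b * v) - 1) % D = (-(b * v) - 1) - D * ((-(b * v) - 1) / D) := by
      rw [Int.emod_def]
    refine ⟨u * b - W * ((-(b * v) - 1) / D), ?_⟩
    rw [hc, h1]
    linear_combination -b * huv
  have hM := Nat.div_add_mod (N + D - c) D
  have hM' := Nat.mod_lt (N + D - c) hD
  refine ⟨c, (N + D - c) / D, hc1, hcD, hdvd, by omega, by omega, fun f => ?_⟩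
  symm
  refine Finset.sum_bij (fun m _ => c + D * m) ?_ ?_ ?_ (fun _ _ => rfl)
  · intro m hm
    have h1 : m + 1 ≤ (N + D - c) / D := Finset.mem_range.1 hm
    have h2 := Nat.mul_le_mul_left D h1
    rw [Finset.mem_filter, Finset.mem_Icc]
    refine ⟨⟨by omega, by rw [mul_add] at h2; omega⟩, ?_⟩
    have h3 : (W : ℤ) * ((c + D * m : ℕ) : ℤ) + b = (W * c + b) + D * (W * m) := by push_cast; ring
    rw [h3]
    exact dvd_add hdvd (Dvd.intro _ rfl)
  · intro m _ m' _ h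
    exact Nat.eq_of_mul_eq_mul_left hD (Nat.add_left_cancel h)
  · intro n hn
    rw [Finset.mem_filter, Finset.mem_Icc] at hn
    obtain ⟨⟨h1, h2⟩, h3⟩ := hn
    have h4 : (D : ℤ) ∣ W * ((n : ℤ) - c) := by
      have := dvd_sub h3 hdvd
      rwa [show (W : ℤ) * n + b - (W * c + b) = W * ((n : ℤ) - c) by ring] at this
    have h5 : (D : ℤ) ∣ (n : ℤ) - c :=
      (Nat.isCoprime_iff_coprime.2 hWD).dvd_of_dvd_mul_left h4
    obtain ⟨k, hk⟩ := h5
    have hk0 : 0 ≤ k := by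
      by_contra h
      have : k ≤ -1 := by omega
      nlinarith
    lift k to ℕ using hk0
    refine ⟨k, ?_, ?_⟩
    · rw [Finset.mem_range, ← Nat.add_one_le_iff, Nat.le_div_iff_mul_le hD]
      have : (n : ℤ) = c + D * k := by linarith
      have h6 : n = c + D * k := by exact_mod_cast this
      rw [add_mul, mul_comm k D]
      omega
    · have : (n : ℤ) = c + D * k := by linarith
      exact_mod_cast this.symm

/-- `E(D) = ∑ e(n θ)` over the `n ∈ [1, N]` with `D ∣ W n + b`. -/
noncomputable def progSum (W : ℕ) (b : ℤ) (N : ℕ) (θ : ℝ) (D : ℕ) : ℂ :=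
  ∑ n ∈ (Finset.Icc 1 N).filter (fun n : ℕ => (D : ℤ) ∣ (W : ℤ) * n + b), expChar (n * θ)

theorem norm_progSum_le_div {W D : ℕ} (hD : 0 < D) (hWD : D.Coprime W) (b : ℤ) (N : ℕ) (θ : ℝ) :
    ‖progSum W b N θ D‖ ≤ (N : ℝ) / D + 1 := by
  obtain ⟨c, M, -, -, -, h1, -, h2⟩ := exists_progression hD hWD b N
  have hD' : (0 : ℝ) < D := by exact_mod_cast hD
  rw [progSum, h2]
  refine (norm_sum_le _ _).trans ?_
  simp only [norm_expChar, Finset.sum_const, Finset.card_range, nsmul_eq_mul, mul_one]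
  have h3 : D * M ≤ N + D := by omega
  have h4 : (D : ℝ) * M ≤ N + D := by exact_mod_cast h3
  rw [div_add_one hD'.ne', le_div_iff₀ hD']
  linarith

theorem norm_progSum_le_of_dist {W D : ℕ} (hD : 0 < D) (hWD : D.Coprime W) (b : ℤ) (N : ℕ)
    {θ t : ℝ} (ht : 0 < t) (h : ∀ k : ℤ, t ≤ |D * θ - k|) :
    ‖progSum W b N θ D‖ ≤ 1 / (2 * t) := by
  obtain ⟨c, M, -, -, -, -, -, h2⟩ := exists_progression hD hWD b N
  have h3 := le_norm_expChar_sub_one h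
  set x := expChar (D * θ) with hx
  have hx1 : x ≠ 1 := by
    rintro hx1
    rw [hx1, sub_self, norm_zero] at h3
    linarith
  have h4 : ∀ m ∈ Finset.range M, expChar (((c + D * m : ℕ) : ℝ) * θ) = expChar (c * θ) * x ^ m := by
    intro m _
    rw [hx, ← expChar_natCast_mul, ← expChar_add]
    push_cast
    ring_nf
  rw [progSum, h2, Finset.sum_congr rfl h4, ← Finset.mul_sum, norm_mul, norm_expChar, one_mul,
    geom_sum_eq hx1, norm_div]
  have h5 : ‖x ^ M - 1‖ ≤ 2 := by
    refine (norm_sub_le _ _).trans ?_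
    rw [norm_pow, hx, norm_expChar, one_pow, norm_one]
    norm_num
  calc _ ≤ 2 / (4 * t) := by gcongr
    _ = _ := by field_simp; norm_num

theorem sum_range_progression (f : ℕ → ℂ) (c D M : ℕ) :
    ∑ m ∈ Finset.range M, ∑ i ∈ Finset.range D, f (c + D * m + i) =
      ∑ n ∈ Finset.Ico c (c + D * M), f n := by
  induction M with
  | zero => simp
  | succ M ih =>
    rw [Finset.sum_range_succ, ih, ← Finset.sum_Ico_consecutive _ (Nat.le_add_right c (D * M))
      (show c + D * M ≤ c + D * (M + 1) by gcongr; omega)]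
    congr 1
    rw [Finset.sum_Ico_eq_sum_range]
    refine Finset.sum_congr ?_ fun _ _ => rfl
    congr 1
    rw [mul_add]
    omega

/-- Compare D copies of each term with the block of D consecutive terms starting there: the phases
differ by at most 2πD|β|. The blocks tile [c, c + DM), which differs from [1, N] in at most 2D
points. -/
theorem norm_sum_progression_sub_le {c D M N : ℕ} (hD : 0 < D) (hDN : D ≤ N) (hc : 1 ≤ c)
    (h1 : c + D * M ≤ N + D) (h2 : N < c + D * M) (hcD : c ≤ D) (β : ℝ) :
    ‖∑ m ∈ Finset.range M, expChar (((c + D * m : ℕ) : ℝ) * β) -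
      (1 / D : ℂ) * ∑ n ∈ Finset.Icc 1 N, expChar (n * β)‖ ≤ 2 + 4 * Real.pi * N * |β| := by
  have hD' : (0 : ℝ) < D := by exact_mod_cast hD
  have hDC : (D : ℂ) ≠ 0 := by exact_mod_cast hD.ne'
  have hpi := Real.pi_pos
  set g : ℕ → ℂ := fun n => expChar (n * β) with hg
  have hgn : ∀ n, ‖g n‖ = 1 := fun n => norm_expChar _
  have k1 : ‖(D : ℂ) * ∑ m ∈ Finset.range M, g (c + D * m) -
      ∑ m ∈ Finset.range M, ∑ i ∈ Finset.range D, g (c + D * m + i)‖ ≤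
        M * (D * (2 * Real.pi * (D * |β|))) := by
    rw [Finset.mul_sum, ← Finset.sum_sub_distrib]
    refine (norm_sum_le_of_le _ (fun m _ => ?_)).trans (by rw [Finset.sum_const, Finset.card_range,
      nsmul_eq_mul])
    rw [← nsmul_eq_mul, ← Finset.card_range D, ← Finset.sum_const, Finset.card_range,
      ← Finset.sum_sub_distrib]
    refine (norm_sum_le_of_le _ (fun i hi => ?_)).trans (by rw [Finset.sum_const, Finset.card_range,
      nsmul_eq_mul])
    have : g (c + D * m + i) = g (c + D * m) * expChar (i * β) := by
      simp only [hg]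
      rw [← expChar_add]
      push_cast
      ring_nf
    rw [this, ← norm_neg, neg_sub, ← mul_sub_one, norm_mul, hgn, one_mul]
    refine (norm_expChar_sub_one_le _).trans ?_
    rw [abs_mul, Nat.abs_cast]
    have : (i : ℝ) ≤ D := by exact_mod_cast (Finset.mem_range.1 hi).le
    gcongr
  have k2 : ‖∑ n ∈ Finset.Ico c (c + D * M), g n - ∑ n ∈ Finset.Icc 1 N, g n‖ ≤ 2 * D := by
    have e1 := Finset.sum_Ico_consecutive g hc (Nat.le_add_right c (D * M))
    have e2 := Finset.sum_Ico_consecutive g (show 1 ≤ N + 1 by omega)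
      (show N + 1 ≤ c + D * M by omega)
    have e3 : ∑ n ∈ Finset.Ico c (c + D * M), g n - ∑ n ∈ Finset.Icc 1 N, g n =
        ∑ n ∈ Finset.Ico (N + 1) (c + D * M), g n - ∑ n ∈ Finset.Ico 1 c, g n := by
      rw [← Finset.Ico_add_one_right_eq_Icc]
      linear_combination e1 - e2
    have hb : ∀ a d : ℕ, ‖∑ n ∈ Finset.Ico a d, g n‖ ≤ (d - a : ℕ) := fun a d => by
      refine (norm_sum_le _ _).trans ?_
      simp [hgn]
    rw [e3]
    refine (norm_sub_le _ _).trans ((add_le_add (hb _ _) (hb _ _)).trans ?_)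
    have : (c + D * M - (N + 1)) + (c - 1) ≤ 2 * D := by omega
    exact_mod_cast this
  rw [sum_range_progression] at k1
  have k3 : ‖(D : ℂ) * ∑ m ∈ Finset.range M, g (c + D * m) - ∑ n ∈ Finset.Icc 1 N, g n‖ ≤
      M * (D * (2 * Real.pi * (D * |β|))) + 2 * D :=
    (norm_sub_le_norm_sub_add_norm_sub _ _ _).trans (add_le_add k1 k2)
  have k4 : ∑ m ∈ Finset.range M, g (c + D * m) - (1 / D : ℂ) * ∑ n ∈ Finset.Icc 1 N, g n =
      (1 / D : ℂ) * ((D : ℂ) * ∑ m ∈ Finset.range M, g (c + D * m) -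
        ∑ n ∈ Finset.Icc 1 N, g n) := by
    field_simp
  have k5 : (D : ℝ) * M ≤ 2 * N := by
    have : D * M ≤ 2 * N := by omega
    exact_mod_cast this
  rw [k4, norm_mul, norm_div, norm_one, Complex.norm_natCast]
  calc 1 / (D : ℝ) * _ ≤ 1 / (D : ℝ) * (M * (D * (2 * Real.pi * (D * |β|))) + 2 * D) := by gcongr
    _ = 2 + 2 * Real.pi * (D * M) * |β| := by field_simp; ring
    _ ≤ 2 + 2 * Real.pi * (2 * N) * |β| := by gcongr
    _ = _ := by ring

/-- The major arc approximation of `E(D)` for the multiples `D` of the denominator. -/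
theorem norm_progSum_sub_le {W D q N : ℕ} (hD : 0 < D) (hDN : D ≤ N) (hWD : D.Coprime W)
    (hqD : q ∣ D) {b n₀ a : ℤ} (hn₀ : (q : ℤ) ∣ W * n₀ + b) (β : ℝ) :
    ‖progSum W b N (a / q + β) D - expChar (n₀ * (a / q)) * ((1 / D : ℂ) *
      ∑ n ∈ Finset.Icc 1 N, expChar (n * β))‖ ≤ 2 + 4 * Real.pi * N * |β| := by
  obtain ⟨c, M, hc, hcle, hcD, h1, h2, h3⟩ := exists_progression hD hWD b N
  have hq : 0 < q := Nat.pos_of_dvd_of_pos hqD hD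
  have hqR : (q : ℝ) ≠ 0 := by exact_mod_cast hq.ne'
  have hqW : IsCoprime (q : ℤ) W := Nat.isCoprime_iff_coprime.2 (hWD.coprime_dvd_left hqD)
  have hqc : (q : ℤ) ∣ c - n₀ := by
    have h4 : (q : ℤ) ∣ W * ((c : ℤ) - n₀) := by
      have := dvd_sub ((Int.natCast_dvd_natCast.2 hqD).trans hcD) hn₀
      rwa [show (W : ℤ) * c + b - (W * n₀ + b) = W * ((c : ℤ) - n₀) by ring] at this
    exact hqW.dvd_of_dvd_mul_left h4
  obtain ⟨j, hj⟩ := hqc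
  obtain ⟨D', rfl⟩ := hqD
  have h4 : ∀ m ∈ Finset.range M, expChar (((c + q * D' * m : ℕ) : ℝ) * (a / q + β)) =
      expChar (n₀ * (a / q)) * expChar (((c + q * D' * m : ℕ) : ℝ) * β) := by
    intro m _
    -- All points of the progression are congruent to n₀ modulo q, so the phase at a/q is constant
    -- and depends only on q, not on D.
    have h5 : ((c + q * D' * m : ℕ) : ℝ) * (a / q + β) = ((j + D' * m) * a : ℤ) +
        (n₀ * (a / q) + ((c + q * D' * m : ℕ) : ℝ) * β) := by
      have h6 : (c : ℝ) = n₀ + q * j := by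
        have : (c : ℤ) = n₀ + q * j := by linarith
        exact_mod_cast this
      push_cast
      rw [h6]
      field_simp
      ring
    rw [h5, expChar_add, expChar_intCast, one_mul, expChar_add]
  rw [progSum, h3, Finset.sum_congr rfl h4, ← Finset.mul_sum, ← mul_sub, norm_mul, norm_expChar,
    one_mul]
  exact norm_sum_progression_sub_le hD hDN hc h1 h2 hcle β

/-! ### Sums over spaced points -/

/-- Cut the circle into arcs of length 1/(2q): by the spacing no arc holds two of the points xθ.
Counting arcs upwards and downwards from 0, a point at index i is at distance at least i/(2q) on
that side, so the bounds 2q/i sum to a harmonic number. Index 0 uses the bound A. -/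
theorem sum_le_of_spaced {B : Finset ℕ} {θ A : ℝ} {q : ℕ} (hq : 0 < q) (hA : 0 ≤ A) {g : ℕ → ℝ}
    (hsp : ∀ x ∈ B, ∀ y ∈ B, y < x → ∀ k : ℤ, 1 / (2 * q : ℝ) ≤ |((x : ℝ) - y) * θ - k|)
    (hgA : ∀ x ∈ B, g x ≤ A)
    (hg : ∀ x ∈ B, ∀ t : ℝ, 0 < t → (∀ k : ℤ, t ≤ |x * θ - k|) → g x ≤ 1 / t) :
    ∑ x ∈ B, g x ≤ 2 * (A + 2 * q * (harmonic (2 * q) : ℚ)) := by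
  have hq' : (0 : ℝ) < q := by exact_mod_cast hq
  set u : ℕ → ℝ := fun i => if i = 0 then A else 2 * q / i with hu
  have hu0 : ∀ i, 0 ≤ u i := fun i => by
    simp only [hu]
    split_ifs <;> positivity
  set I : ℕ → ℕ := fun x => ⌊2 * q * Int.fract (x * θ)⌋₊ with hI
  set I' : ℕ → ℕ := fun x => ⌊2 * q * (1 - Int.fract (x * θ))⌋₊ with hI'
  have hf0 : ∀ x : ℕ, 0 ≤ Int.fract (x * θ) := fun x => Int.fract_nonneg _
  have hf1 : ∀ x : ℕ, 0 ≤ 1 - Int.fract (x * θ) := fun x => by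
    linarith [Int.fract_lt_one (x * θ)]
  have hp : ∀ x ∈ B, g x ≤ u (I x) + u (I' x) := by
    intro x hx
    by_cases h1 : I x = 0
    · rw [h1]
      have : u 0 = A := if_pos rfl
      linarith [hgA x hx, hu0 (I' x)]
    by_cases h2 : I' x = 0
    · rw [h2]
      have : u 0 = A := if_pos rfl
      linarith [hgA x hx, hu0 (I x)]
    have h3 : (0 : ℝ) < I x := by exact_mod_cast Nat.pos_of_ne_zero h1
    have h4 : (0 : ℝ) < I' x := by exact_mod_cast Nat.pos_of_ne_zero h2
    have h5 : (I x : ℝ) ≤ 2 * q * Int.fract (x * θ) :=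
      Nat.floor_le (mul_nonneg (by positivity) (hf0 x))
    have h6 : (I' x : ℝ) ≤ 2 * q * (1 - Int.fract (x * θ)) :=
      Nat.floor_le (mul_nonneg (by positivity) (hf1 x))
    have h7 : ∀ k : ℤ, (min (I x) (I' x) : ℝ) / (2 * q) ≤ |x * θ - k| := by
      intro k
      rw [div_le_iff₀ (by positivity)]
      have h8 := Int.self_sub_floor (x * θ)
      rcases le_or_gt k ⌊x * θ⌋ with hk | hk
      · have hk' : (k : ℝ) ≤ ⌊x * θ⌋ := by exact_mod_cast hk
        have h9 : Int.fract (x * θ) ≤ |x * θ - k| := le_trans (by linarith) (le_abs_self _)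
        calc _ ≤ (I x : ℝ) := min_le_left _ _
          _ ≤ _ := h5
          _ ≤ _ := by rw [mul_comm]; gcongr
      · have hk' : (⌊x * θ⌋ : ℝ) + 1 ≤ k := by exact_mod_cast hk
        have h9 : 1 - Int.fract (x * θ) ≤ |x * θ - k| := le_trans (by linarith) (neg_le_abs _)
        calc _ ≤ (I' x : ℝ) := min_le_right _ _
          _ ≤ _ := h6
          _ ≤ _ := by rw [mul_comm]; gcongr
    refine (hg x hx _ (div_pos (lt_min h3 h4) (by positivity)) h7).trans ?_
    rw [one_div_div]
    rcases min_choice (I x : ℝ) (I' x : ℝ) with h | h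
    · rw [h]
      have : u (I x) = 2 * q / I x := if_neg h1
      linarith [hu0 (I' x)]
    · rw [h]
      have : u (I' x) = 2 * q / I' x := if_neg h2
      linarith [hu0 (I x)]
  have hU : ∑ i ∈ Finset.range (2 * q + 1), u i = A + 2 * q * (harmonic (2 * q) : ℚ) := by
    rw [Finset.sum_range_succ', harmonic, Rat.cast_sum, Finset.mul_sum, add_comm]
    congr 1
    refine Finset.sum_congr rfl fun i _ => ?_
    simp only [hu, Nat.add_eq_zero_iff, one_ne_zero, and_false, if_false]
    push_cast
    rw [div_eq_mul_inv]
  have hnear : ∀ x ∈ B, ∀ y ∈ B, y < x →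
      ¬ |2 * q * Int.fract (x * θ) - 2 * q * Int.fract (y * θ)| < 1 := by
    intro x hx y hy hyx h
    rw [← mul_sub, abs_mul, abs_of_pos (by positivity : (0 : ℝ) < 2 * q)] at h
    have h1 := hsp x hx y hy hyx (⌊x * θ⌋ - ⌊y * θ⌋)
    rw [div_le_iff₀ (by positivity)] at h1
    have h2 : ((x : ℝ) - y) * θ - ((⌊x * θ⌋ - ⌊y * θ⌋ : ℤ) : ℝ) =
        Int.fract (x * θ) - Int.fract (y * θ) := by
      rw [← Int.self_sub_floor, ← Int.self_sub_floor]
      push_cast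
      ring
    rw [h2] at h1
    linarith
  have key : ∀ F : ℕ → ℕ, (∀ x ∈ B, F x < 2 * q + 1) → Set.InjOn F B →
      ∑ x ∈ B, u (F x) ≤ A + 2 * q * (harmonic (2 * q) : ℚ) := by
    intro F hF hinj
    rw [← hU, ← Finset.sum_image hinj]
    refine Finset.sum_le_sum_of_subset_of_nonneg (fun i hi => ?_) fun _ _ _ => hu0 _
    obtain ⟨x, hx, rfl⟩ := Finset.mem_image.1 hi
    exact Finset.mem_range.2 (hF x hx)
  have hinj : ∀ F : ℕ → ℕ, (∀ x ∈ B, ∀ y ∈ B, y < x → F x ≠ F y) → Set.InjOn F B := by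
    intro F hF x hx y hy h
    rcases lt_trichotomy x y with h1 | h1 | h1
    · exact absurd h.symm (hF y hy x hx h1)
    · exact h1
    · exact absurd h (hF x hx y hy h1)
  -- The index 2q does occur: it is the downward index of a point with fractional part 0.
  have hlt : ∀ v : ℝ, v ≤ 1 → ⌊2 * q * v⌋₊ < 2 * q + 1 := by
    intro v hv
    refine Nat.lt_succ_of_le (Nat.floor_le_of_le ?_)
    push_cast
    nlinarith
  have s1 := key I (fun x _ => hlt _ (Int.fract_lt_one _).le) (hinj I fun x hx y hy hyx h => by
    refine hnear x hx y hy hyx ?_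
    have a1 := Nat.floor_le (mul_nonneg (by positivity : (0 : ℝ) ≤ 2 * q) (hf0 x))
    have a2 := Nat.floor_le (mul_nonneg (by positivity : (0 : ℝ) ≤ 2 * q) (hf0 y))
    have a3 := Nat.lt_floor_add_one (2 * q * Int.fract (x * θ))
    have a4 := Nat.lt_floor_add_one (2 * q * Int.fract (y * θ))
    have h' : (⌊2 * q * Int.fract (x * θ)⌋₊ : ℝ) = ⌊2 * q * Int.fract (y * θ)⌋₊ :=
      congrArg Nat.cast h
    rw [abs_lt]
    constructor <;> linarith)
  have s2 := key I' (fun x _ => hlt _ (by linarith [hf0 x])) (hinj I' fun x hx y hy hyx h => by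
    refine hnear x hx y hy hyx ?_
    have a1 := Nat.floor_le (mul_nonneg (by positivity : (0 : ℝ) ≤ 2 * q) (hf1 x))
    have a2 := Nat.floor_le (mul_nonneg (by positivity : (0 : ℝ) ≤ 2 * q) (hf1 y))
    have a3 := Nat.lt_floor_add_one (2 * q * (1 - Int.fract (x * θ)))
    have a4 := Nat.lt_floor_add_one (2 * q * (1 - Int.fract (y * θ)))
    have h' : (⌊2 * q * (1 - Int.fract (x * θ))⌋₊ : ℝ) = ⌊2 * q * (1 - Int.fract (y * θ))⌋₊ :=
      congrArg Nat.cast h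
    rw [abs_lt]
    constructor <;> linarith)
  refine (Finset.sum_le_sum hp).trans ?_
  rw [Finset.sum_add_distrib]
  linarith

theorem sum_Icc_le_of_spaced {θ : ℝ} {q X N : ℕ} (hq : 0 < q) (hqN : q ≤ N) (hXN : X ≤ N)
    {g : ℕ → ℝ}
    (hsp : ∀ h : ℕ, 0 < h → 2 * h ≤ q → ∀ k : ℤ, 1 / (2 * q : ℝ) ≤ |h * θ - k|)
    (hgN : ∀ D ∈ Finset.Icc 1 X, g D ≤ (N : ℝ) / D + 1)
    (hgt : ∀ D ∈ Finset.Icc 1 X, ∀ t : ℝ, 0 < t → (∀ k : ℤ, t ≤ |D * θ - k|) → g D ≤ 1 / t) :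
    ∑ D ∈ Finset.Icc 1 X, g D ≤ 14 * ((N : ℝ) / q + X + q) * (1 + Real.log (2 * N)) := by
  have hq' : (0 : ℝ) < q := by exact_mod_cast hq
  have hq1 : (1 : ℝ) ≤ q := by exact_mod_cast hq
  have hqN' : (q : ℝ) ≤ N := by exact_mod_cast hqN
  have hN1 : (1 : ℝ) ≤ N := hq1.trans hqN'
  -- Blocks of ⌈q/2⌉ consecutive D: differences h inside a block satisfy 2h ≤ q, as the spacing
  -- hypothesis requires. In block 0 the hypothesis applies to D itself and gives the bound 2q; in
  -- block j > 0, D ≥ jq/2 makes the trivial bound 2N/(jq) + 1.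
  set L := (q + 1) / 2 with hL
  have hL0 : 0 < L := by omega
  have hqL : (q : ℝ) ≤ 2 * L := by
    have : q ≤ 2 * L := by omega
    exact_mod_cast this
  set H : ℝ := ((harmonic (2 * q) : ℚ) : ℝ) with hH
  set J := X / L with hJ
  set A : ℕ → ℝ := fun j => if j = 0 then 2 * q else 2 * N / (j * q) + 1 with hA
  have hA0 : ∀ j, 0 ≤ A j := fun j => by
    simp only [hA]
    split_ifs <;> positivity
  have hblock : ∀ j ∈ Finset.range (J + 1),
      ∑ D ∈ (Finset.Icc 1 X).filter (fun D => D / L = j), g D ≤ 2 * (A j + 2 * q * H) := by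
    intro j _
    refine sum_le_of_spaced (θ := θ) hq (hA0 j) ?_ ?_ ?_
    · intro x hx y hy hyx k
      have h1 := (Finset.mem_filter.1 hx).2
      have h2 := (Finset.mem_filter.1 hy).2
      have h3 := Nat.div_add_mod x L
      have h4 := Nat.div_add_mod y L
      have h5 := Nat.mod_lt x hL0
      rw [h1] at h3
      rw [h2] at h4
      have h6 := hsp (x - y) (by omega) (by omega) k
      rwa [Nat.cast_sub hyx.le] at h6
    · intro D hD
      obtain ⟨h1, h2⟩ := Finset.mem_filter.1 hD
      have hD1 := (Finset.mem_Icc.1 h1).1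
      by_cases hj : j = 0
      · subst hj
        have h3 : D < L := by
          by_contra h
          exact absurd h2 (Nat.div_pos (not_lt.1 h) hL0).ne'
        have h4 := hgt D h1 _ (by positivity) (hsp D hD1 (by omega))
        rw [one_div_one_div] at h4
        exact h4.trans (le_of_eq (if_pos rfl).symm)
      · have hj0 : (0 : ℝ) < j := by exact_mod_cast Nat.pos_of_ne_zero hj
        have h3 : j * L ≤ D := by rw [← h2]; exact Nat.div_mul_le_self D L
        have h4 : (j : ℝ) * L ≤ D := by exact_mod_cast h3
        have h5 : A j = 2 * N / (j * q) + 1 := if_neg hj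
        rw [h5]
        refine (hgN D h1).trans (add_le_add ?_ le_rfl)
        have hD' : (0 : ℝ) < D := by exact_mod_cast hD1
        rw [div_le_div_iff₀ hD' (by positivity)]
        have : (j : ℝ) * q ≤ 2 * D := by nlinarith
        nlinarith
    · intro D hD t ht h
      exact hgt D (Finset.mem_filter.1 hD).1 t ht h
  have hmaps : ∀ D ∈ Finset.Icc 1 X, D / L ∈ Finset.range (J + 1) := by
    intro D hD
    rw [Finset.mem_range, Nat.lt_add_one_iff]
    exact Nat.div_le_div_right (Finset.mem_Icc.1 hD).2
  rw [← Finset.sum_fiberwise_of_maps_to hmaps]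
  refine (Finset.sum_le_sum hblock).trans ?_
  rw [Finset.sum_range_succ']
  have hsum : ∑ j ∈ Finset.range J, 2 * (A (j + 1) + 2 * q * H) =
      4 * N / q * (harmonic J : ℚ) + 2 * J + 4 * q * H * J := by
    have h1 : ∀ j ∈ Finset.range J, 2 * (A (j + 1) + 2 * q * H) =
        4 * N / q * (((j + 1 : ℕ) : ℝ))⁻¹ + (2 + 4 * q * H) := by
      intro j _
      have : A (j + 1) = 2 * N / ((j + 1 : ℕ) * q) + 1 := if_neg (Nat.succ_ne_zero j)
      rw [this]
      have : (0 : ℝ) < (j + 1 : ℕ) := by positivity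
      field_simp
      ring
    rw [Finset.sum_congr rfl h1, Finset.sum_add_distrib, ← Finset.mul_sum, harmonic]
    simp only [Finset.sum_const, Finset.card_range, nsmul_eq_mul]
    push_cast
    ring
  rw [hsum, show A 0 = 2 * q from if_pos rfl]
  set ℓ := 1 + Real.log (2 * N) with hℓ
  have hℓ1 : 1 ≤ ℓ := by
    have := Real.log_nonneg (show (1 : ℝ) ≤ 2 * N by linarith)
    linarith
  have hHℓ : H ≤ ℓ := by
    refine (harmonic_le_one_add_log _).trans ?_
    push_cast
    rw [hℓ]
    gcongr
  have hJN : J ≤ N := (Nat.div_le_self X L).trans hXN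
  have hJℓ : ((harmonic J : ℚ) : ℝ) ≤ ℓ := by
    refine (harmonic_le_one_add_log _).trans ?_
    rcases Nat.eq_zero_or_pos J with h | h
    · rw [h, Nat.cast_zero, Real.log_zero]
      linarith
    · have h' : (0 : ℝ) < J := by exact_mod_cast h
      have : (J : ℝ) ≤ N := by exact_mod_cast hJN
      have : (J : ℝ) ≤ 2 * N := by linarith
      rw [hℓ]
      gcongr
  have hJX : (J : ℝ) * q ≤ 2 * X := by
    have h1 : J * L ≤ X := Nat.div_mul_le_self X L
    have h2 : (J : ℝ) * L ≤ X := by exact_mod_cast h1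
    have : (0 : ℝ) ≤ J := Nat.cast_nonneg J
    nlinarith
  have hJX' : (J : ℝ) ≤ 2 * X := by
    have : (0 : ℝ) ≤ J := Nat.cast_nonneg J
    nlinarith
  have hNq : 0 ≤ 4 * (N : ℝ) / q := by positivity
  have hX0 : (0 : ℝ) ≤ X := Nat.cast_nonneg X
  have hH0 : 0 ≤ H := by
    rw [hH, harmonic]
    push_cast
    positivity
  calc 4 * (N : ℝ) / q * (harmonic J : ℚ) + 2 * J + 4 * q * H * J + 2 * (2 * q + 2 * q * H)
      = 4 * (N : ℝ) / q * (harmonic J : ℚ) + 2 * J + 4 * H * (J * q) + (4 * q * 1 + 4 * q * H) := by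
        ring
    _ ≤ 4 * (N : ℝ) / q * ℓ + 2 * (2 * X) + 4 * ℓ * (2 * X) + (4 * q * ℓ + 4 * q * ℓ) := by
        gcongr
    _ ≤ _ := by
        have : 0 ≤ (N : ℝ) / q * ℓ := by positivity
        rw [mul_div_assoc]
        nlinarith [mul_nonneg hX0 (show 0 ≤ ℓ - 1 by linarith), mul_nonneg hX0 (show 0 ≤ ℓ by linarith),
          mul_nonneg hq'.le (show 0 ≤ ℓ by linarith)]

/-! ### Expansion of the Fourier transform over pairs of weights. -/

theorem coprime_of_dvd_selbergP {z : ℝ} {W d : ℕ} (h : d ∣ selbergP z W) : d.Coprime W :=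
  Nat.Coprime.coprime_dvd_left h (Nat.Coprime.prod_left fun _ hp => (Finset.mem_filter.1 hp).2.2)

theorem fourierSum_selbergMajorant (z : ℝ) (W : ℕ) (b : ℤ) (N : ℕ) (θ : ℝ) :
    fourierSum N (selbergMajorant z W b) θ = ((W.totient : ℝ) / W * Real.log z : ℝ) *
      ∑ d₁ ∈ (selbergP z W).divisors, ∑ d₂ ∈ (selbergP z W).divisors,
        ((selbergWeight z W d₁ * selbergWeight z W d₂ : ℝ) : ℂ) *
          progSum W b N θ (d₁.lcm d₂) := by
  set D := (selbergP z W).divisors with hD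
  have h1 : ∀ n : ℕ, ((∑ d ∈ D.filter (fun d : ℕ => (d : ℤ) ∣ (W : ℤ) * n + b),
      selbergWeight z W d) ^ 2 : ℝ) = ∑ d₁ ∈ D, ∑ d₂ ∈ D,
      if ((d₁.lcm d₂ : ℕ) : ℤ) ∣ (W : ℤ) * n + b then
        selbergWeight z W d₁ * selbergWeight z W d₂ else 0 := by
    intro n
    rw [sq, Finset.sum_filter, Finset.sum_mul_sum]
    refine Finset.sum_congr rfl fun d₁ _ => Finset.sum_congr rfl fun d₂ _ => ?_
    simp only [Int.natCast_dvd, Nat.lcm_dvd_iff]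
    by_cases k1 : d₁ ∣ ((W : ℤ) * n + b).natAbs <;>
      by_cases k2 : d₂ ∣ ((W : ℤ) * n + b).natAbs <;> simp [k1, k2]
  have h2 : ∀ n ∈ Finset.Icc 1 N, (selbergMajorant z W b n : ℂ) *
      Complex.exp (2 * Real.pi * Complex.I * (n * θ : ℝ)) =
      ((W.totient : ℝ) / W * Real.log z : ℝ) * ∑ d₁ ∈ D, ∑ d₂ ∈ D,
        if ((d₁.lcm d₂ : ℕ) : ℤ) ∣ (W : ℤ) * n + b then
          ((selbergWeight z W d₁ * selbergWeight z W d₂ : ℝ) : ℂ) * expChar (n * θ) else 0 := by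
    intro n _
    rw [selbergMajorant, h1 n, Complex.ofReal_mul, mul_assoc, Complex.ofReal_sum, Finset.sum_mul]
    congr 1
    refine Finset.sum_congr rfl fun d₁ _ => ?_
    rw [Complex.ofReal_sum, Finset.sum_mul]
    refine Finset.sum_congr rfl fun d₂ _ => ?_
    split_ifs
    · rw [expChar]
    · rw [Complex.ofReal_zero, zero_mul]
  refine (Finset.sum_congr rfl h2).trans ?_
  rw [← Finset.mul_sum]
  refine congrArg _ ?_
  rw [Finset.sum_comm]
  refine Finset.sum_congr rfl fun d₁ _ => ?_
  rw [Finset.sum_comm]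
  refine Finset.sum_congr rfl fun d₂ _ => ?_
  rw [progSum, Finset.mul_sum]
  exact (Finset.sum_filter _ _).symm

/-- Group the pairs by D = [d₁, d₂], which is below z² because the weights vanish from z on. There
are at most τ(D)² pairs, each with product of weights at most τ(D)². -/
theorem sum_weights_lcm_le {z T : ℝ} (hz : 1 < z) {W X : ℕ} (hX : ∀ n : ℕ, (n : ℝ) < z ^ 2 → n ≤ X)
    (hT : ∀ D ∈ Finset.Icc 1 X, (D.divisors.card : ℝ) ^ 4 ≤ T) {F : ℕ → ℝ} (hF : ∀ D, 0 ≤ F D) :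
    ∑ d₁ ∈ (selbergP z W).divisors, ∑ d₂ ∈ (selbergP z W).divisors,
      |selbergWeight z W d₁ * selbergWeight z W d₂| * F (d₁.lcm d₂) ≤
      T * ∑ D ∈ (Finset.Icc 1 X).filter (fun D => D ∣ selbergP z W), F D := by
  set P := selbergP z W with hP
  set S := (P.divisors ×ˢ P.divisors).filter (fun x : ℕ × ℕ => (x.1 : ℝ) < z ∧ (x.2 : ℝ) < z) with hS
  rw [← Finset.sum_product', ← Finset.sum_subset (Finset.filter_subset _ _ :
    S ⊆ P.divisors ×ˢ P.divisors)]
  swap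
  · intro x hx hxS
    have : z ≤ x.1 ∨ z ≤ x.2 := by
      by_contra h
      push Not at h
      exact hxS (Finset.mem_filter.2 ⟨hx, h⟩)
    rcases this with h | h
    · rw [selbergWeight_eq_zero h]; simp
    · rw [selbergWeight_eq_zero h]; simp
  have hmaps : ∀ x ∈ S, x.1.lcm x.2 ∈ (Finset.Icc 1 X).filter (fun D => D ∣ P) := by
    intro x hx
    obtain ⟨h1, h2, h3⟩ := Finset.mem_filter.1 hx
    obtain ⟨h4, h5⟩ := Finset.mem_product.1 h1
    refine Finset.mem_filter.2 ⟨Finset.mem_Icc.2 ⟨Nat.lcm_pos (Nat.pos_of_mem_divisors h4)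
      (Nat.pos_of_mem_divisors h5), hX _ ?_⟩,
      Nat.lcm_dvd (Nat.dvd_of_mem_divisors h4) (Nat.dvd_of_mem_divisors h5)⟩
    have h6 : x.1.lcm x.2 ≤ x.1 * x.2 := Nat.le_of_dvd
      (Nat.mul_pos (Nat.pos_of_mem_divisors h4) (Nat.pos_of_mem_divisors h5)) (Nat.lcm_dvd_mul _ _)
    calc ((x.1.lcm x.2 : ℕ) : ℝ) ≤ x.1 * x.2 := by exact_mod_cast h6
      _ < z * z := by
        have : (0 : ℝ) < x.2 := by exact_mod_cast Nat.pos_of_mem_divisors h5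
        have : (0 : ℝ) < x.1 := by exact_mod_cast Nat.pos_of_mem_divisors h4
        nlinarith
      _ = z ^ 2 := (sq z).symm
  rw [← Finset.sum_fiberwise_of_maps_to hmaps, Finset.mul_sum]
  refine Finset.sum_le_sum fun D hD => ?_
  have hDI := (Finset.mem_filter.1 hD).1
  have hD0 : D ≠ 0 := by have := (Finset.mem_Icc.1 hDI).1; omega
  have hsub : S.filter (fun x => x.1.lcm x.2 = D) ⊆ D.divisors ×ˢ D.divisors := by
    intro x hx
    have h := (Finset.mem_filter.1 hx).2
    rw [Finset.mem_product, Nat.mem_divisors, Nat.mem_divisors, ← h]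
    rw [← h] at hD0
    exact ⟨⟨Nat.dvd_lcm_left _ _, hD0⟩, Nat.dvd_lcm_right _ _, hD0⟩
  calc ∑ x ∈ S.filter (fun x => x.1.lcm x.2 = D),
        |selbergWeight z W x.1 * selbergWeight z W x.2| * F (x.1.lcm x.2)
      ≤ ∑ x ∈ S.filter (fun x => x.1.lcm x.2 = D), (D.divisors.card : ℝ) ^ 2 * F D := by
        refine Finset.sum_le_sum fun x hx => ?_
        obtain ⟨k1, k2⟩ := Finset.mem_product.1 (hsub hx)
        have e1 : |selbergWeight z W x.1| ≤ D.divisors.card := (abs_selbergWeight_le hz W _).trans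
          (by exact_mod_cast card_divisors_le_of_dvd hD0 (Nat.dvd_of_mem_divisors k1))
        have e2 : |selbergWeight z W x.2| ≤ D.divisors.card := (abs_selbergWeight_le hz W _).trans
          (by exact_mod_cast card_divisors_le_of_dvd hD0 (Nat.dvd_of_mem_divisors k2))
        rw [(Finset.mem_filter.1 hx).2, abs_mul, sq]
        have := hF D
        gcongr
    _ ≤ ∑ x ∈ D.divisors ×ˢ D.divisors, (D.divisors.card : ℝ) ^ 2 * F D :=
        Finset.sum_le_sum_of_subset_of_nonneg hsub fun _ _ _ => mul_nonneg (by positivity) (hF D)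
    _ = (D.divisors.card : ℝ) ^ 4 * F D := by
        rw [Finset.sum_const, Finset.card_product, nsmul_eq_mul]
        push_cast
        ring
    _ ≤ T * F D := mul_le_mul_of_nonneg_right (hT D hDI) (hF D)

/-- Replacing `E(D)` by its main term in the expansion of the Fourier transform. -/
theorem norm_sum_weights_sub_le {z T : ℝ} (hz : 1 < z) {W X : ℕ}
    (hX : ∀ n : ℕ, (n : ℝ) < z ^ 2 → n ≤ X)
    (hT : ∀ D ∈ Finset.Icc 1 X, (D.divisors.card : ℝ) ^ 4 ≤ T) (q : ℕ) (G : ℂ) (E : ℕ → ℂ) :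
    ‖∑ d₁ ∈ (selbergP z W).divisors, ∑ d₂ ∈ (selbergP z W).divisors,
        ((selbergWeight z W d₁ * selbergWeight z W d₂ : ℝ) : ℂ) * E (d₁.lcm d₂) -
      lcmCoeff z W q * G‖ ≤
    T * ∑ D ∈ (Finset.Icc 1 X).filter (fun D => D ∣ selbergP z W),
      ‖E D - if q ∣ D then (1 / D : ℂ) * G else 0‖ := by
  refine le_trans ?_ (sum_weights_lcm_le hz hX hT fun D => norm_nonneg _)
  rw [lcmCoeff]
  push_cast
  rw [Finset.sum_mul, ← Finset.sum_sub_distrib]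
  refine norm_sum_le_of_le _ fun d₁ _ => ?_
  rw [Finset.sum_mul, ← Finset.sum_sub_distrib]
  refine norm_sum_le_of_le _ fun d₂ _ => ?_
  rw [← Real.norm_eq_abs, ← Complex.norm_real, ← norm_mul]
  apply le_of_eq
  congr 1
  split_ifs
  · push_cast
    ring
  · push_cast
    ring

/-- When q ∤ D, the fraction Da/q is at least 1/q from every integer, and passing from a/q to θ
moves it by at most D/((Q + 1)q) ≤ 1/(2q). -/
theorem dist_mul_of_not_dvd {x : ℚ} {D Q : ℕ} {θ : ℝ} (hD : ¬ x.den ∣ D)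
    (hθ : |θ - x| ≤ 1 / (((Q : ℝ) + 1) * x.den)) (hDQ : 2 * D ≤ Q + 1) (k : ℤ) :
    1 / (2 * x.den : ℝ) ≤ |D * θ - k| := by
  have hq : (0 : ℝ) < x.den := by exact_mod_cast x.den_pos
  have h1 : (x : ℝ) = x.num / x.den := Rat.cast_def x
  have h2 : (D : ℤ) * x.num - k * x.den ≠ 0 := by
    intro h
    have h3 : (x.den : ℤ) ∣ x.num * D := ⟨k, by linear_combination h⟩
    have h4 : IsCoprime (x.den : ℤ) x.num := by
      rw [Int.isCoprime_iff_gcd_eq_one, Int.gcd_comm]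
      exact x.reduced
    exact hD (Int.natCast_dvd_natCast.1 (h4.dvd_of_dvd_mul_left h3))
  have h5 : (1 : ℝ) ≤ |(D : ℝ) * x.num - k * x.den| := by exact_mod_cast Int.one_le_abs h2
  have h6 : 1 / (x.den : ℝ) ≤ |D * (x : ℝ) - k| := by
    have : D * (x : ℝ) - k = ((D : ℝ) * x.num - k * x.den) / x.den := by
      rw [h1]; field_simp
    rw [this, abs_div, abs_of_pos hq]
    gcongr
  have h7 : |D * (θ - x)| ≤ 1 / (2 * x.den : ℝ) := by
    rw [abs_mul, Nat.abs_cast]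
    have h8 : (2 : ℝ) * D ≤ Q + 1 := by exact_mod_cast hDQ
    calc (D : ℝ) * |θ - x| ≤ ((Q + 1) / 2) * (1 / (((Q : ℝ) + 1) * x.den)) := by
          gcongr
          linarith
      _ = _ := by field_simp
  have h9 : D * (x : ℝ) - k = (D * θ - k) - D * (θ - x) := by ring
  have h10 := abs_sub (D * θ - k) (D * (θ - x))
  rw [← h9] at h10
  have h11 : 1 / (x.den : ℝ) = 1 / (2 * x.den) + 1 / (2 * x.den) := by field_simp; norm_num
  linarith

/-! ### Major and minor arcs. -/

/-- The sizes of the parameters of the sieve. -/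
theorem sieve_parameters {N : ℕ} {δ : ℝ} (hδ : 0 < δ) (hδ2 : δ < 1 / 2)
    (hN : 2 ≤ (N : ℝ) ^ δ) :
    2 ≤ N ∧ 1 < (N : ℝ) ^ (1 / 2 - δ) ∧
    ((⌊((N : ℝ) ^ (1 / 2 - δ)) ^ 2⌋₊ : ℕ) : ℝ) * (N : ℝ) ^ δ ≤ (N : ℝ) ^ (1 - δ) ∧
    2 * ⌊((N : ℝ) ^ (1 / 2 - δ)) ^ 2⌋₊ ≤ ⌊(N : ℝ) ^ (1 - δ)⌋₊ + 1 ∧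
    ⌊((N : ℝ) ^ (1 / 2 - δ)) ^ 2⌋₊ ≤ N ∧ ⌊(N : ℝ) ^ (1 - δ)⌋₊ ≤ N := by
  have hN2 : 2 ≤ N := by
    by_contra h
    have h1 : (N : ℝ) ≤ 1 := by
      have : N ≤ 1 := by omega
      exact_mod_cast this
    have := Real.rpow_le_one (Nat.cast_nonneg N) h1 hδ.le
    linarith
  have hN1 : (1 : ℝ) < N := by exact_mod_cast hN2
  have hN0 : (0 : ℝ) < N := by linarith
  have hz2 : ((N : ℝ) ^ (1 / 2 - δ)) ^ 2 = (N : ℝ) ^ (1 - 2 * δ) := by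
    rw [← Real.rpow_natCast, ← Real.rpow_mul hN0.le]
    congr 1
    push_cast
    ring
  rw [hz2]
  have hX := Nat.floor_le (Real.rpow_nonneg hN0.le (1 - 2 * δ))
  have hle : ∀ s : ℝ, s ≤ 1 → ⌊(N : ℝ) ^ s⌋₊ ≤ N := fun s hs => by
    refine Nat.floor_le_of_le ((Real.rpow_le_rpow_of_exponent_le hN1.le hs).trans ?_)
    rw [Real.rpow_one]
  have hmul : (N : ℝ) ^ (1 - 2 * δ) * (N : ℝ) ^ δ = (N : ℝ) ^ (1 - δ) := by
    rw [← Real.rpow_add hN0]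
    congr 1
    ring
  have h3 : ((⌊(N : ℝ) ^ (1 - 2 * δ)⌋₊ : ℕ) : ℝ) * (N : ℝ) ^ δ ≤ (N : ℝ) ^ (1 - δ) := by
    rw [← hmul]
    gcongr
  refine ⟨hN2, Real.one_lt_rpow hN1 (by linarith), h3, ?_, hle _ (by linarith), hle _ (by linarith)⟩
  have h4 := Nat.lt_floor_add_one ((N : ℝ) ^ (1 - δ))
  have h5 : (2 : ℝ) * (⌊(N : ℝ) ^ (1 - 2 * δ)⌋₊ : ℕ) ≤ (⌊(N : ℝ) ^ (1 - δ)⌋₊ : ℕ) + 1 := by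
    have : (0 : ℝ) ≤ (⌊(N : ℝ) ^ (1 - 2 * δ)⌋₊ : ℕ) := Nat.cast_nonneg _
    nlinarith
  exact_mod_cast h5

/-- The error term in the approximation of the Fourier transform of the majorant, before the
factor `(φ(W) / W) log z`. -/
noncomputable def fourierError (C δ : ℝ) (N : ℕ) : ℝ :=
  C ^ 4 * (N : ℝ) ^ (δ / 4) * (42 * (N : ℝ) ^ (1 - δ) * (1 + Real.log (2 * N)))

theorem card_divisors_pow_four_le {C δ : ℝ}
    (hC : ∀ n : ℕ, (n.divisors.card : ℝ) ≤ C * (n : ℝ) ^ δ) (n : ℕ) :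
    (n.divisors.card : ℝ) ^ 4 ≤ C ^ 4 * (n : ℝ) ^ (4 * δ) := by
  calc (n.divisors.card : ℝ) ^ 4 ≤ (C * (n : ℝ) ^ δ) ^ 4 := by
        gcongr
        exact hC n
    _ = _ := by
        rw [mul_pow, ← Real.rpow_natCast ((n : ℝ) ^ δ), ← Real.rpow_mul (Nat.cast_nonneg n)]
        congr 2
        push_cast
        ring

/-- Major arcs: each of the at most N^(1-2δ) moduli D has error at most 15 N^δ. The solution n₀ is
demanded only when q ∣ P, since otherwise no D in the sum is a multiple of q. -/
theorem norm_sum_weights_sub_le_fourierError {N W : ℕ} {b n₀ : ℤ} {C δ θ : ℝ} {x : ℚ}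
    (hδ : 0 < δ) (hδ2 : δ < 1 / 2)
    (hN : 2 ≤ (N : ℝ) ^ δ) (hC : ∀ n : ℕ, (n.divisors.card : ℝ) ≤ C * (n : ℝ) ^ (δ / 16))
    (hx : |θ - x| ≤ 1 / ((((⌊(N : ℝ) ^ (1 - δ)⌋₊ : ℕ) : ℝ) + 1) * x.den))
    (hxN : (x.den : ℝ) ≤ (N : ℝ) ^ δ)
    (hn₀ : x.den ∣ selbergP ((N : ℝ) ^ (1 / 2 - δ)) W → (x.den : ℤ) ∣ W * n₀ + b) :
    ‖∑ d₁ ∈ (selbergP ((N : ℝ) ^ (1 / 2 - δ)) W).divisors,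
      ∑ d₂ ∈ (selbergP ((N : ℝ) ^ (1 / 2 - δ)) W).divisors,
        ((selbergWeight ((N : ℝ) ^ (1 / 2 - δ)) W d₁ *
          selbergWeight ((N : ℝ) ^ (1 / 2 - δ)) W d₂ : ℝ) : ℂ) * progSum W b N θ (d₁.lcm d₂) -
      lcmCoeff ((N : ℝ) ^ (1 / 2 - δ)) W x.den * (expChar (n₀ * (x.num / x.den)) *
        ∑ n ∈ Finset.Icc 1 N, expChar (n * (θ - x)))‖ ≤ fourierError C δ N := by
  obtain ⟨hN2, hz, hXN, hXQ, hX, -⟩ := sieve_parameters hδ hδ2 hN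
  set z := (N : ℝ) ^ (1 / 2 - δ) with hzdef
  set X := ⌊z ^ 2⌋₊ with hXdef
  set Q := ⌊(N : ℝ) ^ (1 - δ)⌋₊ with hQ
  have hN1 : (1 : ℝ) ≤ N := by exact_mod_cast one_le_two.trans hN2
  have hN0 : (0 : ℝ) < N := by linarith
  have hq : (0 : ℝ) < x.den := by exact_mod_cast x.den_pos
  have hq1 : (1 : ℝ) ≤ x.den := by exact_mod_cast x.den_pos
  have hT : ∀ D ∈ Finset.Icc 1 X, (D.divisors.card : ℝ) ^ 4 ≤ C ^ 4 * (N : ℝ) ^ (δ / 4) := by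
    intro D hD
    have hDN : (D : ℝ) ≤ N := by exact_mod_cast (Finset.mem_Icc.1 hD).2.trans hX
    refine (card_divisors_pow_four_le hC D).trans ?_
    rw [show 4 * (δ / 16) = δ / 4 by ring]
    gcongr
  refine (norm_sum_weights_sub_le hz (fun n hn => Nat.le_floor hn.le) hT x.den _ _).trans ?_
  rw [fourierError]
  refine mul_le_mul_of_nonneg_left ?_ (by positivity)
  have hbound : ∀ D ∈ (Finset.Icc 1 X).filter (fun D => D ∣ selbergP z W),
      ‖progSum W b N θ D - if x.den ∣ D then (1 / D : ℂ) * (expChar (n₀ * (x.num / x.den)) *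
        ∑ n ∈ Finset.Icc 1 N, expChar (n * (θ - x))) else 0‖ ≤ 15 * (N : ℝ) ^ δ := by
    intro D hD
    obtain ⟨hD1, hDP⟩ := Finset.mem_filter.1 hD
    obtain ⟨hD0, hDX⟩ := Finset.mem_Icc.1 hD1
    have hDW := coprime_of_dvd_selbergP hDP
    split_ifs with h
    · have h1 := norm_progSum_sub_le hD0 (hDX.trans hX) hDW h (a := x.num)
        (hn₀ (h.trans hDP)) (θ - x)
      have h2 : (x.num : ℝ) / x.den + (θ - x) = θ := by rw [Rat.cast_def]; ring
      rw [h2, mul_left_comm] at h1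
      refine h1.trans ?_
      have h3 : N * |θ - x| ≤ (N : ℝ) ^ δ := by
        have h4 := Nat.lt_floor_add_one ((N : ℝ) ^ (1 - δ))
        have h5 : (0 : ℝ) < (N : ℝ) ^ (1 - δ) := by positivity
        calc (N : ℝ) * |θ - x| ≤ N * (1 / ((N : ℝ) ^ (1 - δ) * 1)) := by
              refine mul_le_mul_of_nonneg_left (hx.trans ?_) hN0.le
              gcongr
          _ = (N : ℝ) ^ δ := by
              rw [mul_one, mul_one_div, div_eq_iff h5.ne', ← Real.rpow_add hN0]
              simp
      have hpi := Real.pi_lt_d2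
      have hpi0 := Real.pi_pos
      calc 2 + 4 * Real.pi * N * |θ - x| = 2 + 4 * Real.pi * (N * |θ - x|) := by ring
        _ ≤ 2 + 4 * 3.15 * (N : ℝ) ^ δ := by gcongr
        _ ≤ _ := by linarith
    · rw [sub_zero]
      refine (norm_progSum_le_of_dist hD0 hDW b N (by positivity)
        (dist_mul_of_not_dvd h hx (by omega))).trans ?_
      have : 1 / (2 * (1 / (2 * (x.den : ℝ)))) = x.den := by field_simp
      rw [this]
      linarith
  have hlog : 0 ≤ Real.log (2 * N) := Real.log_nonneg (by linarith)
  calc _ ≤ (((Finset.Icc 1 X).filter (fun D => D ∣ selbergP z W)).card : ℝ) *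
        (15 * (N : ℝ) ^ δ) := by
        rw [← nsmul_eq_mul]
        exact Finset.sum_le_card_nsmul _ _ _ hbound
    _ ≤ X * (15 * (N : ℝ) ^ δ) := by
        gcongr
        refine (Finset.card_filter_le _ _).trans ?_
        simp
    _ = 15 * (X * (N : ℝ) ^ δ) * 1 := by ring
    _ ≤ 42 * (N : ℝ) ^ (1 - δ) * (1 + Real.log (2 * N)) := by
        gcongr
        · norm_num
        · linarith

/-- Minor arcs: no main term is extracted. Summing |E(D)| over all D gives (N/q + X + q) log N up to
a constant, and each of the three terms is at most N^(1-δ) when N^δ ≤ q ≤ N^(1-δ). -/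
theorem norm_sum_weights_le_fourierError {N W : ℕ} {b : ℤ} {C δ θ : ℝ} {x : ℚ}
    (hδ : 0 < δ) (hδ2 : δ < 1 / 2)
    (hN : 2 ≤ (N : ℝ) ^ δ) (hC : ∀ n : ℕ, (n.divisors.card : ℝ) ≤ C * (n : ℝ) ^ (δ / 16))
    (hx : |θ - x| ≤ 1 / ((((⌊(N : ℝ) ^ (1 - δ)⌋₊ : ℕ) : ℝ) + 1) * x.den))
    (hxQ : x.den ≤ ⌊(N : ℝ) ^ (1 - δ)⌋₊)
    (hxN : (N : ℝ) ^ δ ≤ x.den) :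
    ‖∑ d₁ ∈ (selbergP ((N : ℝ) ^ (1 / 2 - δ)) W).divisors,
      ∑ d₂ ∈ (selbergP ((N : ℝ) ^ (1 / 2 - δ)) W).divisors,
        ((selbergWeight ((N : ℝ) ^ (1 / 2 - δ)) W d₁ *
          selbergWeight ((N : ℝ) ^ (1 / 2 - δ)) W d₂ : ℝ) : ℂ) * progSum W b N θ (d₁.lcm d₂)‖ ≤
      fourierError C δ N := by
  obtain ⟨hN2, hz, hXN, hXQ, hX, hQN⟩ := sieve_parameters hδ hδ2 hN
  set z := (N : ℝ) ^ (1 / 2 - δ) with hzdef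
  set X := ⌊z ^ 2⌋₊ with hXdef
  set Q := ⌊(N : ℝ) ^ (1 - δ)⌋₊ with hQ
  have hN1 : (1 : ℝ) ≤ N := by exact_mod_cast one_le_two.trans hN2
  have hN0 : (0 : ℝ) < N := by linarith
  have hq : (0 : ℝ) < x.den := by exact_mod_cast x.den_pos
  have hT : ∀ D ∈ Finset.Icc 1 X, (D.divisors.card : ℝ) ^ 4 ≤ C ^ 4 * (N : ℝ) ^ (δ / 4) := by
    intro D hD
    have hDN : (D : ℝ) ≤ N := by exact_mod_cast (Finset.mem_Icc.1 hD).2.trans hX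
    refine (card_divisors_pow_four_le hC D).trans ?_
    rw [show 4 * (δ / 16) = δ / 4 by ring]
    gcongr
  have h0 := norm_sum_weights_sub_le (W := W) hz (fun n hn => Nat.le_floor hn.le) hT x.den 0
    (progSum W b N θ)
  simp only [mul_zero, ite_self, sub_zero] at h0
  refine h0.trans ?_
  rw [fourierError]
  refine mul_le_mul_of_nonneg_left ?_ (by positivity)
  rw [Finset.sum_filter]
  have hlog : 0 ≤ Real.log (2 * N) := Real.log_nonneg (by linarith)
  refine (sum_Icc_le_of_spaced (θ := θ) x.den_pos (hxQ.trans hQN) hX ?_ ?_ ?_).trans ?_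
  · intro h h1 h2
    exact dist_mul_of_not_dvd (fun hd => by have := Nat.le_of_dvd h1 hd; omega) hx (by omega)
  · intro D hD
    split_ifs with h
    · exact norm_progSum_le_div (Finset.mem_Icc.1 hD).1 (coprime_of_dvd_selbergP h) b N θ
    · positivity
  · intro D hD t ht hk
    split_ifs with h
    · refine (norm_progSum_le_of_dist (Finset.mem_Icc.1 hD).1 (coprime_of_dvd_selbergP h) b N ht
        hk).trans ?_
      gcongr
      linarith
    · positivity
  · have e1 : (N : ℝ) / x.den ≤ (N : ℝ) ^ (1 - δ) := by
      rw [div_le_iff₀ hq]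
      calc (N : ℝ) = (N : ℝ) ^ (1 - δ) * (N : ℝ) ^ δ := by
            rw [← Real.rpow_add hN0]; simp
        _ ≤ _ := by gcongr
    have e2 : (X : ℝ) ≤ (N : ℝ) ^ (1 - δ) := by
      have : (0 : ℝ) ≤ X := Nat.cast_nonneg X
      nlinarith
    have e3 : (x.den : ℝ) ≤ (N : ℝ) ^ (1 - δ) :=
      (Nat.cast_le.2 hxQ).trans (Nat.floor_le (by positivity))
    calc 14 * ((N : ℝ) / x.den + X + x.den) * (1 + Real.log (2 * N))
        ≤ 14 * ((N : ℝ) ^ (1 - δ) + (N : ℝ) ^ (1 - δ) + (N : ℝ) ^ (1 - δ)) *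
          (1 + Real.log (2 * N)) := by gcongr
      _ = _ := by ring

/-- The divisor bound costs N^(δ/4) and each of the two logarithms N^(δ/8), together half of the
saving N^δ. -/
theorem tendsto_fourierError {C δ : ℝ} (hδ : 0 < δ) :
    Filter.Tendsto (fun N : ℕ => Real.log N * fourierError C δ N / N) Filter.atTop (nhds 0) := by
  set K := C ^ 4 * 42 * (8 / δ * (2 + 8 / δ)) with hK
  have hlim : Filter.Tendsto (fun N : ℕ => K * (N : ℝ) ^ (-(δ / 2))) Filter.atTop (nhds 0) := by
    have := (tendsto_rpow_neg_atTop (half_pos hδ)).comp tendsto_natCast_atTop_atTop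
    simpa using this.const_mul K
  refine squeeze_zero' ?_ ?_ hlim
  · filter_upwards [Filter.eventually_ge_atTop 1] with N hN
    have hN1 : (1 : ℝ) ≤ N := by exact_mod_cast hN
    have h1 := Real.log_nonneg hN1
    have h2 : 0 ≤ Real.log (2 * N) := Real.log_nonneg (by linarith)
    rw [fourierError]
    positivity
  · filter_upwards [Filter.eventually_ge_atTop 1] with N hN
    have hN1 : (1 : ℝ) ≤ N := by exact_mod_cast hN
    have hN0 : (0 : ℝ) < N := by linarith
    have h0 := Real.log_nonneg hN1
    have h1 : Real.log N ≤ 8 / δ * (N : ℝ) ^ (δ / 8) := by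
      refine (Real.log_le_rpow_div hN0.le (show 0 < δ / 8 by positivity)).trans (le_of_eq ?_)
      field_simp
    have h2 : (1 : ℝ) ≤ (N : ℝ) ^ (δ / 8) := Real.one_le_rpow hN1 (by positivity)
    have h3 : 1 + Real.log (2 * N) ≤ (2 + 8 / δ) * (N : ℝ) ^ (δ / 8) := by
      rw [Real.log_mul (by norm_num) hN0.ne']
      have := Real.log_two_lt_d9
      nlinarith
    have h5 : (N : ℝ) ^ (δ / 8) * ((N : ℝ) ^ (δ / 4) * ((N : ℝ) ^ (1 - δ) * (N : ℝ) ^ (δ / 8))) =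
        (N : ℝ) ^ (-(δ / 2)) * N := by
      rw [← Real.rpow_add hN0, ← Real.rpow_add hN0, ← Real.rpow_add hN0, ← Real.rpow_add_one hN0.ne']
      congr 1
      ring
    rw [div_le_iff₀ hN0, fourierError]
    calc Real.log N * (C ^ 4 * (N : ℝ) ^ (δ / 4) *
          (42 * (N : ℝ) ^ (1 - δ) * (1 + Real.log (2 * N))))
        ≤ (8 / δ * (N : ℝ) ^ (δ / 8)) * (C ^ 4 * (N : ℝ) ^ (δ / 4) *
          (42 * (N : ℝ) ^ (1 - δ) * ((2 + 8 / δ) * (N : ℝ) ^ (δ / 8)))) := by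
          have : 0 ≤ 1 + Real.log (2 * N) := by
            have := Real.log_nonneg (show (1 : ℝ) ≤ 2 * N by linarith)
            linarith
          gcongr
      _ = K * ((N : ℝ) ^ (δ / 8) * ((N : ℝ) ^ (δ / 4) * ((N : ℝ) ^ (1 - δ) *
          (N : ℝ) ^ (δ / 8)))) := by rw [hK]; ring
      _ = _ := by rw [h5]; ring

/-! ### The coefficient of a denominator coprime to the primorial, and the theorem. -/

theorem one_lt_primorial {w : ℝ} (hw : 2 ≤ w) : 1 < primorial ⌊w⌋₊ := by
  have h : 2 ≤ ⌊w⌋₊ := Nat.le_floor (by exact_mod_cast hw)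
  have := primorial_mono h
  rw [primorial_two] at this
  omega

theorem lt_of_coprime_primorial {w : ℝ} (hw : 2 ≤ w) {q : ℕ} (hq0 : q ≠ 0) (hq : q ≠ 1)
    (hqW : q.Coprime (primorial ⌊w⌋₊)) : w < q := by
  have hp := Nat.minFac_prime hq
  have h1 : ¬ q.minFac ≤ ⌊w⌋₊ := by
    rw [← hp.dvd_primorial_iff]
    intro h
    have h3 := Nat.dvd_gcd (Nat.minFac_dvd q) h
    rw [hqW.gcd_eq_one] at h3
    exact hp.one_lt.ne' (Nat.dvd_one.1 h3)
  have h2 : ⌊w⌋₊ < q := (not_le.1 h1).trans_le (Nat.minFac_le (Nat.pos_of_ne_zero hq0))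
  exact (Nat.floor_lt (by linarith)).1 h2

theorem lcmCoeff_eq_zero {z : ℝ} {W v : ℕ} (hv : ¬ v ∣ selbergP z W) : lcmCoeff z W v = 0 := by
  refine Finset.sum_eq_zero fun d₁ h₁ => Finset.sum_eq_zero fun d₂ h₂ => ?_
  rw [if_neg]
  exact fun h => hv (h.trans
    (Nat.lcm_dvd (Nat.dvd_of_mem_divisors h₁) (Nat.dvd_of_mem_divisors h₂)))

/-- A rational approximation of `r / N`, which is `0` for `r = 0`. -/
theorem exists_rat_approx {Q : ℕ} (hQ : 0 < Q) (θ : ℝ) :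
    ∃ x : ℚ, |θ - x| ≤ 1 / (((Q : ℝ) + 1) * x.den) ∧ x.den ≤ Q ∧ (θ = 0 → x.den = 1) := by
  -- Choosing 0 for θ = 0 puts r = 0 in the case q = 1, the only one with a main term.
  by_cases h : θ = 0
  · refine ⟨0, ?_, hQ, fun _ => rfl⟩
    rw [h]
    simp only [Rat.cast_zero, sub_zero, abs_zero]
    positivity
  · obtain ⟨x, h1, h2⟩ := Real.exists_rat_abs_sub_le_and_den_le θ hQ
    exact ⟨x, h1, h2, fun h' => absurd h' h⟩

theorem exists_dvd_mul_add {q W : ℕ} (h : q.Coprime W) (b : ℤ) :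
    ∃ n₀ : ℤ, (q : ℤ) ∣ W * n₀ + b := by
  obtain ⟨u, v, huv⟩ := Nat.isCoprime_iff_coprime.2 h
  exact ⟨-(b * v), u * b, by linear_combination -b * huv⟩

/-- The bound τ(q)⁴/q is at most C⁴ q^(-1+ε), which decreases in q as ε ≤ 1, so q > w can be
inserted. When q ∤ P the coefficient is 0. -/
theorem abs_lcmCoeff_le_rpow {z w c C ε : ℝ} (hz : 1 < z) (hw : 2 ≤ w) {q : ℕ}
    (hq0 : q ≠ 0) (hq : q ≠ 1) (hε1 : ε ≤ 1)
    (hC : ∀ n : ℕ, (n.divisors.card : ℝ) ≤ C * (n : ℝ) ^ (ε / 4)) (hc0 : 0 ≤ c)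
    (hc : c * (selbergJ z (primorial ⌊w⌋₊))⁻¹ ≤ 2) :
    c * |lcmCoeff z (primorial ⌊w⌋₊) q| ≤ 2 * C ^ 4 * w ^ (-1 + ε) := by
  have hw0 : 0 < w := by linarith
  have hJ := selbergJ_pos hz (primorial ⌊w⌋₊)
  by_cases hP : q ∣ selbergP z (primorial ⌊w⌋₊)
  · have hwq := lt_of_coprime_primorial hw hq0 hq (coprime_of_dvd_selbergP hP)
    have hq' : (0 : ℝ) < q := hw0.trans hwq
    have h1 : (q.divisors.card : ℝ) ^ 4 / q ≤ C ^ 4 * w ^ (-1 + ε) := by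
      calc (q.divisors.card : ℝ) ^ 4 / q ≤ C ^ 4 * (q : ℝ) ^ (4 * (ε / 4)) / q := by
            gcongr
            exact card_divisors_pow_four_le hC q
        _ = C ^ 4 * (q : ℝ) ^ (-1 + ε) := by
            rw [mul_div_assoc, ← Real.rpow_sub_one hq'.ne']
            ring_nf
        _ ≤ C ^ 4 * w ^ (-1 + ε) := by
            gcongr ?_ * ?_
            exact Real.rpow_le_rpow_of_nonpos hw0 hwq.le (by linarith)
    calc c * |lcmCoeff z (primorial ⌊w⌋₊) q|
        ≤ c * ((q.divisors.card : ℝ) ^ 4 / (q * selbergJ z (primorial ⌊w⌋₊))) := by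
          gcongr
          exact abs_lcmCoeff_le hz hP
      _ = (c * (selbergJ z (primorial ⌊w⌋₊))⁻¹) * ((q.divisors.card : ℝ) ^ 4 / q) := by
          field_simp
      _ ≤ 2 * (C ^ 4 * w ^ (-1 + ε)) := by gcongr
      _ = _ := by ring
  · rw [lcmCoeff_eq_zero hP, abs_zero, mul_zero]
    positivity

theorem norm_sum_expChar_le (N : ℕ) (β : ℝ) : ‖∑ n ∈ Finset.Icc 1 N, expChar (n * β)‖ ≤ N := by
  refine (norm_sum_le _ _).trans ?_
  simp [norm_expChar]

end SelbergPseudorandom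

open SelbergPseudorandom in
theorem mainTheorem4 :
    ∃ C : ℝ → ℝ, ∀ w : ℝ, 2 ≤ w → ∀ δ : ℝ, 0 < δ → δ < 1 / 2 →
      ∃ N₀ : ℕ, ∀ N : ℕ, N₀ ≤ N → ∀ b : ℤ, IsCoprime b (primorial ⌊w⌋₊ : ℤ) →
        ∀ ε : ℝ, 0 < ε →
          IsPseudorandom N (C ε * w ^ (-1 + ε))
            (selbergMajorant ((N : ℝ) ^ (1 / 2 - δ)) (primorial ⌊w⌋₊) b) := by
  have hdiv : ∀ η : ℝ, ∃ C : ℝ, 1 ≤ C ∧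
      (0 < η → ∀ n : ℕ, (n.divisors.card : ℝ) ≤ C * (n : ℝ) ^ η) := fun η => by
    by_cases hη : 0 < η
    · obtain ⟨C, h1, h2⟩ := exists_card_divisors_le_rpow hη
      exact ⟨C, h1, fun _ => h2⟩
    · exact ⟨1, le_rfl, fun h => absurd h hη⟩
  choose K hK1 hK using hdiv
  -- One unit pays for `fourierError`, one for c/J - 1 when q = 1, and 2K⁴ for the coefficient when
  -- q > 1, using c/J ≤ 2. Truncating ε at 1 keeps the exponent -1 + ε nonpositive.
  refine ⟨fun ε => 2 + 2 * K (min ε 1 / 4) ^ 4, fun w hw δ hδ hδ2 => ?_⟩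
  have hw0 : 0 < w := by linarith
  set W := primorial ⌊w⌋₊ with hWdef
  have hW : 1 < W := one_lt_primorial hw
  have hztop : Filter.Tendsto (fun N : ℕ => (N : ℝ) ^ (1 / 2 - δ)) Filter.atTop Filter.atTop :=
    (tendsto_rpow_atTop (by linarith)).comp tendsto_natCast_atTop_atTop
  have hδtop : Filter.Tendsto (fun N : ℕ => (N : ℝ) ^ δ) Filter.atTop Filter.atTop :=
    (tendsto_rpow_atTop hδ).comp tendsto_natCast_atTop_atTop
  -- The tolerance 1/w is at most w^(-1+ε) for every ε > 0, so a single N₀ serves all ε.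
  have e1 := (Metric.tendsto_nhds.1 ((tendsto_log_div_selbergJ hW).comp hztop)) (1 / w)
    (by positivity)
  have e2 := (Metric.tendsto_nhds.1 (tendsto_fourierError (C := K (δ / 16)) hδ)) (1 / w)
    (by positivity)
  obtain ⟨N₀, hN₀⟩ := Filter.eventually_atTop.1 (e1.and (e2.and (hδtop.eventually_ge_atTop 2)))
  refine ⟨N₀, fun N hN b _ ε hε r => ?_⟩
  obtain ⟨h1, h2, h3⟩ := hN₀ N hN
  obtain ⟨hN2, hz, -, -, -, -⟩ := sieve_parameters hδ hδ2 h3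
  simp only [Function.comp_apply, Real.dist_eq, sub_zero] at h1 h2
  set z := (N : ℝ) ^ (1 / 2 - δ) with hzdef
  have hN0 : (0 : ℝ) < N := by exact_mod_cast zero_lt_two.trans_le hN2
  have hN1 : (1 : ℝ) ≤ N := by exact_mod_cast one_le_two.trans hN2
  have : NeZero N := ⟨by omega⟩
  have hrN : r.val < N := ZMod.val_lt r
  have hr0 : r = 0 ↔ r.val = 0 := (ZMod.val_eq_zero r).symm
  set θ : ℝ := (r.val : ℝ) / N with hθ
  set c : ℝ := (W.totient : ℝ) / W * Real.log z with hcdef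
  have hc0 : 0 ≤ c := mul_nonneg (by positivity) (Real.log_nonneg hz.le)
  have hcN : c ≤ Real.log N := by
    have hW' : (0 : ℝ) < W := by exact_mod_cast zero_lt_one.trans hW
    have k1 : (W.totient : ℝ) / W ≤ 1 := by
      rw [div_le_one hW']
      exact_mod_cast Nat.totient_le W
    have k2 : Real.log z ≤ Real.log N := by
      rw [hzdef, Real.log_rpow hN0]
      nlinarith [Real.log_nonneg hN1]
    calc c ≤ 1 * Real.log z := mul_le_mul_of_nonneg_right k1 (Real.log_nonneg hz.le)
      _ ≤ _ := by rw [one_mul]; exact k2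
  have hcJ : c * (selbergJ z W)⁻¹ ≤ 2 := by
    have := (abs_lt.1 h1).2
    have : 1 / w ≤ 1 := by rw [div_le_one hw0]; linarith
    linarith
  have hErr : c * fourierError (K (δ / 16)) δ N ≤ 1 / w * N := by
    have hF : 0 ≤ fourierError (K (δ / 16)) δ N := by
      rw [fourierError]
      have := Real.log_nonneg (show (1 : ℝ) ≤ 2 * N by linarith)
      positivity
    rw [← div_le_iff₀ hN0]
    calc c * fourierError (K (δ / 16)) δ N / N ≤
          Real.log N * fourierError (K (δ / 16)) δ N / N := by gcongr
      _ ≤ _ := (le_abs_self _).trans h2.le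
  have hwε : 1 / w ≤ w ^ (-1 + ε) := by
    rw [one_div, ← Real.rpow_neg_one]
    exact Real.rpow_le_rpow_of_exponent_le (by linarith) (by linarith)
  have hwε' : w ^ (-1 + min ε 1) ≤ w ^ (-1 + ε) :=
    Real.rpow_le_rpow_of_exponent_le (by linarith) (by linarith [min_le_left ε 1])
  have hK0 : 0 ≤ 2 * K (min ε 1 / 4) ^ 4 := by
    have := hK1 (min ε 1 / 4)
    positivity
  have hwp : 0 ≤ w ^ (-1 + ε) := by positivity
  suffices hmain : ‖fourierSum N (selbergMajorant z W b) θ - (if r = 0 then (N : ℂ) else 0)‖ ≤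
      1 / w * N + max (1 / w) (2 * K (min ε 1 / 4) ^ 4 * w ^ (-1 + min ε 1)) * N by
    refine hmain.trans ?_
    rw [← add_mul]
    refine mul_le_mul_of_nonneg_right ?_ hN0.le
    have k1 : max (1 / w) (2 * K (min ε 1 / 4) ^ 4 * w ^ (-1 + min ε 1)) ≤
        (1 + 2 * K (min ε 1 / 4) ^ 4) * w ^ (-1 + ε) := by
      refine max_le ?_ ?_
      · nlinarith [mul_nonneg hK0 hwp]
      · nlinarith [mul_le_mul_of_nonneg_left hwε' hK0]
    linarith
  obtain ⟨x, hx, hxQ, hx0⟩ := exists_rat_approx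
    (Nat.floor_pos.2 (Real.one_le_rpow hN1 (show 0 ≤ 1 - δ by linarith))) θ
  rw [fourierSum_selbergMajorant, ← hcdef]
  have hmax0 : 0 ≤ max (1 / w) (2 * K (min ε 1 / 4) ^ 4 * w ^ (-1 + min ε 1)) :=
    le_max_of_le_left (by positivity)
  rcases le_total (x.den : ℝ) ((N : ℝ) ^ δ) with hmaj | hmin
  · obtain ⟨n₀, hn₀⟩ : ∃ n₀ : ℤ, x.den ∣ selbergP z W → (x.den : ℤ) ∣ W * n₀ + b := by
      by_cases h : x.den ∣ selbergP z W
      · obtain ⟨n₀, h'⟩ := exists_dvd_mul_add (coprime_of_dvd_selbergP h) b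
        exact ⟨n₀, fun _ => h'⟩
      · exact ⟨0, fun h' => absurd h' h⟩
    have hE := norm_sum_weights_sub_le_fourierError hδ hδ2 h3 (hK (δ / 16) (by positivity)) hx hmaj
      hn₀
    rw [← hzdef] at hE
    set S := ∑ d₁ ∈ (selbergP z W).divisors, ∑ d₂ ∈ (selbergP z W).divisors,
      ((selbergWeight z W d₁ * selbergWeight z W d₂ : ℝ) : ℂ) * progSum W b N θ (d₁.lcm d₂)
    set G := expChar (n₀ * (x.num / x.den)) * ∑ n ∈ Finset.Icc 1 N, expChar (n * (θ - x)) with hG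
    have hfirst : ‖(c : ℂ) * S - c * (lcmCoeff z W x.den * G)‖ ≤ 1 / w * N := by
      rw [← mul_sub, norm_mul, Complex.norm_real, Real.norm_of_nonneg hc0]
      exact (mul_le_mul_of_nonneg_left hE hc0).trans hErr
    refine (norm_sub_le_norm_sub_add_norm_sub _ _ _).trans (add_le_add hfirst ?_)
    by_cases hq : x.den = 1
    · have hxi : (x : ℝ) = (x.num : ℤ) := by rw [Rat.cast_def, hq]; simp
      have hG' : G = if r = 0 then (N : ℂ) else 0 := by
        rw [hG, hq]
        have k1 : ((n₀ : ℝ) * (x.num / (1 : ℕ))) = ((n₀ * x.num : ℤ) : ℝ) := by push_cast; ring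
        have k2 : ∀ n ∈ Finset.Icc 1 N, expChar (n * (θ - x)) = expChar (n * θ) := by
          intro n _
          have k3 : (n : ℝ) * (θ - x) = ((-(n * x.num) : ℤ) : ℝ) + n * θ := by
            rw [hxi]; push_cast; ring
          rw [k3, expChar_add, expChar_intCast, one_mul]
        rw [k1, expChar_intCast, one_mul, Finset.sum_congr rfl k2, hθ, sum_expChar_complete hrN]
        simp only [hr0]
      rw [hG', hq, lcmCoeff_one hz]
      have k4 : (c : ℂ) * (((selbergJ z W)⁻¹ : ℝ) * (if r = 0 then (N : ℂ) else 0)) -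
          (if r = 0 then (N : ℂ) else 0) =
          ((c * (selbergJ z W)⁻¹ - 1 : ℝ) : ℂ) * (if r = 0 then (N : ℂ) else 0) := by
        push_cast
        ring
      rw [k4, norm_mul, Complex.norm_real, Real.norm_eq_abs]
      refine mul_le_mul (h1.le.trans (le_max_left _ _)) ?_ (norm_nonneg _) hmax0
      split_ifs <;> simp
    · have hr : r ≠ 0 := fun h => hq (hx0 (by rw [hθ, hr0.1 h]; simp))
      rw [if_neg hr, sub_zero, norm_mul, norm_mul, Complex.norm_real, Complex.norm_real,
        Real.norm_of_nonneg hc0, Real.norm_eq_abs, ← mul_assoc]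
      have hmin0 : 0 < min ε 1 := lt_min hε one_pos
      refine mul_le_mul ((abs_lcmCoeff_le_rpow hz hw x.den_pos.ne' hq (min_le_right _ _)
        (hK _ (by positivity)) hc0 hcJ).trans (le_max_right _ _)) ?_
        (norm_nonneg _) hmax0
      rw [hG, norm_mul, norm_expChar, one_mul]
      exact norm_sum_expChar_le N _
  · have hE := norm_sum_weights_le_fourierError (W := W) (b := b) hδ hδ2 h3
      (hK (δ / 16) (by positivity)) hx hxQ hmin
    rw [← hzdef] at hE
    -- For r = 0 the denominator would be 1, whereas it is at least N^δ ≥ 2 here.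
    have hr : r ≠ 0 := by
      intro h
      have := hx0 (by rw [hθ, hr0.1 h]; simp)
      rw [this] at hmin
      push_cast at hmin
      linarith
    rw [if_neg hr, sub_zero, norm_mul, Complex.norm_real, Real.norm_of_nonneg hc0]
    have := (mul_le_mul_of_nonneg_left hE hc0).trans hErr
    have := mul_nonneg hmax0 hN0.le
    linarith
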